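/- Work in ZFC. All theories are first-order theories $T$ in the language $\{=,\in,A\}$, with $A$ a unary predicate, that include the axiom $V=L[A]$; that is, every transitive model of $T$ has the form $(L_\alpha[A],\in,A)$ with $\alpha$ a limit ordinal. A transitive structure $M$ in this language is maximal if there are no transitive structure $N$ and non-trivial elementary embedding $j\colon M\to N$ (the only trivial embedding is the identity of $M$ onto $N=M$). Let $\mathfrak{Sp}_T$ be the class of all ordinals $\alpha$ such that some maximal transitive model $M$ of $T$ has $M\cap\mathrm{Ord}=\alpha$. **Lemma.** There is a recursive theory $T$ such that $\mathfrak{Sp}_T$ is bounded if and only if there is a measurable cardinal, and in this case $\sup\mathfrak{Sp}_T$ is the least measurable cardinal. Moreover, $T$ can be chosen such that, for every infinite cardinal $\rho$: 1. there are a limit ordinal $\alpha$ and a class $A$ coding an enumeration of $\mathcal P(\rho)$ without repetitions in order type $\alpha$ (that is, $\xi\mapsto\{i<\rho : (\xi,i)\in A\}$ is a bijection from $\alpha$ onto $\mathcal P(\rho)$) such that $(L_\alpha[A],\in,A)$ is a model of $T$; 2. whenever $M=(L_\alpha[A],\in,A)$ is such a model, every non-trivial elementary embedding of $M$ into a transitive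 structure has a critical point, which is a measurable cardinal $\le\rho$; in particular, $M$ is maximal if $\rho$ is smaller than every measurable cardinal. Finally, for every infinite cardinal $\rho$ and every $A$, the conclusion of item 2 also holds for $M=(H(\rho^+),\in,A)$. -/

import Mathlib

open Cardinal

universe u

namespace TransSpectra

/-! ### The language `{=, ∈, A}` and recursive theories -/

/-- The relation symbols: binary `∈` and the unary predicate `A`. -/
inductive SetRel : ℕ → Type
  | mem : SetRel 2
  | pred : SetRel 1

/-- The first-order language `{=, ∈, A}` (equality is built into the logic). -/
abbrev lang : FirstOrder.Language.{0, 0} where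
  Functions := fun _ => Empty
  Relations := SetRel

/-- A term of `lang` without free variables is a bound variable; this is its index. -/
def varIndex {n : ℕ} : lang.Term (Empty ⊕ Fin n) → ℕ
  | .var (.inl e) => e.elim
  | .var (.inr i) => i
  | .func f _ => Empty.elim f

/-- The Gödel number of an atomic formula `x ∈ y` or `A(x)`, given the indices of its variables. -/
def atomCode : {l : ℕ} → SetRel l → (Fin l → ℕ) → ℕ
  | _, .mem, v => Nat.pair 2 (Nat.pair (v 0) (v 1))
  | _, .pred, v => Nat.pair 3 (v 0)

/-- The Gödel number of a formula of `lang` all of whose variables are bound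
variables (levels `0, …, n - 1`). -/
def code : {n : ℕ} → lang.BoundedFormula Empty n → ℕ
  | _, .falsum => Nat.pair 0 0
  | _, .equal s t => Nat.pair 1 (Nat.pair (varIndex s) (varIndex t))
  | _, .rel R ts => atomCode R (fun i => varIndex (ts i))
  | _, .imp φ ψ => Nat.pair 4 (Nat.pair (code φ) (code ψ))
  | _, .all φ => Nat.pair 5 (code φ)

/-- A theory is recursive if the set of Gödel numbers of its members is decidable. -/
def IsRecursiveTheory (T : lang.Theory) : Prop :=
  ComputablePred fun m : ℕ => ∃ φ ∈ T, code φ = m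

/-! ### Transitive structures, elementary embeddings, spectra -/

/-- A structure `(X, ∈, A ∩ X)` for `lang`, where `X` is a set. -/
structure SetStr : Type (u + 1) where
  X : ZFSet.{u}
  A : Set ZFSet.{u}

namespace SetStr

/-- The underlying domain. -/
def Dom (M : SetStr.{u}) : Type (u + 1) := {x : ZFSet.{u} // x ∈ M.X}

instance (M : SetStr.{u}) : lang.Structure M.Dom where
  funMap := fun f _ => Empty.elim f
  RelMap := fun R v => match R, v with
    | .mem, v => (v 0).1 ∈ (v 1).1
    | .pred, v => (v 0).1 ∈ M.A

/-- `M` is transitive as a set. -/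
def Transitive (M : SetStr.{u}) : Prop := M.X.IsTransitive

/-- `M ⊨ T`. -/
def Models (M : SetStr.{u}) (T : lang.Theory) : Prop :=
  FirstOrder.Language.Theory.Model (L := lang) M.Dom T

/-- `M ∩ Ord = α`, where an ordinal is identified with its von Neumann ordinal. -/
def HasHeight (M : SetStr.{u}) (α : Ordinal.{u}) : Prop :=
  ∀ o : Ordinal.{u}, o.toZFSet ∈ M.X ↔ o < α

/-- Elementary embeddings in the full language `{=, ∈, A}`. -/
abbrev ElemEmb (M N : SetStr.{u}) : Type (u + 1) :=
  FirstOrder.Language.ElementaryEmbedding lang M.Dom N.Dom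

/-- The only trivial embedding is the identity of `M` onto `N = M`. -/
def ElemEmb.IsTrivial {M N : SetStr.{u}} (j : ElemEmb M N) : Prop :=
  N.X = M.X ∧ ∀ x : M.Dom, (j x).1 = x.1

/-- `M` is maximal: there are no transitive `N` and non-trivial elementary `j : M → N`. -/
def IsMaximal (M : SetStr.{u}) : Prop :=
  ∀ N : SetStr.{u}, N.Transitive → ∀ j : ElemEmb M N, j.IsTrivial

/-- `ζ` is the critical point of `j`: the least ordinal (of `M`) that `j` moves. -/
def ElemEmb.IsCrit {M N : SetStr.{u}} (j : ElemEmb M N) (ζ : Ordinal.{u}) : Prop :=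
  (∃ h : ζ.toZFSet ∈ M.X, (j ⟨ζ.toZFSet, h⟩).1 ≠ ζ.toZFSet) ∧
    ∀ o < ζ, ∀ h : o.toZFSet ∈ M.X, (j ⟨o.toZFSet, h⟩).1 = o.toZFSet

end SetStr

/-- `Sp T`: the class of all heights of maximal transitive models of `T`. -/
def Sp (T : lang.Theory) : Set Ordinal.{u} :=
  {α | ∃ M : SetStr.{u}, M.Transitive ∧ M.Models T ∧ M.HasHeight α ∧ M.IsMaximal}

/-! ### Relative constructibility -/

/-- `Def^A(X)`: the set of all `y ⊆ X` that are definable over `(X, ∈, A ∩ X)` with parameters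
from `X`. -/
noncomputable def DefPow (A : Set ZFSet.{u}) (X : ZFSet.{u}) : ZFSet.{u} :=
  ZFSet.sep (fun y =>
    Set.Definable₁ (Set.univ : Set (SetStr.mk X A).Dom) lang {x | x.1 ∈ y}) X.powerset

/-- The hierarchy `L_α[A] = ⋃_{β < α} Def^A(L_β[A])`. It is the usual one: `L_0[A] = ∅`,
`L_{β+1}[A] = Def^A(L_β[A])`, and unions are taken at limits. -/
noncomputable def LL (A : Set ZFSet.{u}) (α : Ordinal.{u}) : ZFSet.{u} :=
  ZFSet.iUnion fun β : Set.Iio α => DefPow A (LL A β)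
termination_by α
decreasing_by exact β.2

/-- The structure `(L_α[A], ∈, A ∩ L_α[A])`. -/
noncomputable def LStr (A : Set ZFSet.{u}) (α : Ordinal.{u}) : SetStr.{u} := ⟨LL A α, A⟩

/-- `T` includes the axiom `V = L[A]`, in the standard sense of that axiom for transitive
structures: every transitive model `(X, ∈, A)` of `T` is of the form `X = L_α[A]`, with `α` a limit
ordinal. -/
def IncludesVEqLA (T : lang.Theory) : Prop :=
  ∀ M : SetStr.{u}, M.Transitive → M.Models T →
    ∃ α : Ordinal.{u}, Order.IsSuccLimit α ∧ M.X = LL M.A α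

/-- `A` codes an enumeration `⟨X_ξ : ξ < α⟩` of `𝒫(ρ)` (without repetitions) in order type `α`:
`X_ξ = {i < ρ : (ξ, i) ∈ A}`. -/
def CodesPowerset (A : Set ZFSet.{u}) (ρ : Cardinal.{u}) (α : Ordinal.{u}) : Prop :=
  Set.BijOn
    (fun ξ : Ordinal.{u} => {i : Ordinal.{u} | i < ρ.ord ∧ ZFSet.pair ξ.toZFSet i.toZFSet ∈ A})
    (Set.Iio α) (𝒫 (Set.Iio ρ.ord))

/-! ### `H(θ)` and measurable cardinals -/

/-- `H(θ)`, for an infinite cardinal `θ`: the set of all `x` whose transitive closure has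
cardinality less than `θ`. (All such `x` have rank below `θ`.) -/
noncomputable def HH (θ : Cardinal.{u}) : ZFSet.{u} :=
  ZFSet.sep (fun x => ∃ t : ZFSet.{u}, t.IsTransitive ∧ x ⊆ t ∧ t.card < θ)
    (ZFSet.vonNeumann θ.ord)

/-- `κ` is a measurable cardinal: it is uncountable, and there is a non-principal `κ`-complete
ultrafilter on a set of cardinality `κ`. -/
def IsMeasurableCardinal (κ : Cardinal.{u}) : Prop :=
  ℵ₀ < κ ∧ ∃ X : Type u, #X = κ ∧ ∃ U : Ultrafilter X,
    CardinalInterFilter (U : Filter X) κ ∧ ∀ x : X, ({x} : Set X) ∉ U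

/-- Every non-trivial elementary embedding of `M` into a transitive structure has a critical
point, and this critical point is a measurable cardinal `≤ ρ`. -/
def MeasurableCrit (M : SetStr.{u}) (ρ : Cardinal.{u}) : Prop :=
  ∀ N : SetStr.{u}, N.Transitive → ∀ j : M.ElemEmb N, ¬ j.IsTrivial →
    ∃ κ : Cardinal.{u}, κ ≤ ρ ∧ IsMeasurableCardinal κ ∧ j.IsCrit κ.ord

end TransSpectra

-- `T` is a single sentence σ, so it is recursive. Of a transitive structure it says that it is
-- closed under `(x, y) ↦ y ∪ {x}` and that `A` codes three things: satisfaction in `(ℓ, ∈, A)` for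
-- every element `ℓ`, the levels `L_β[A]`, and a pairing function on every `δ` containing `∅` and
-- closed under successor. A transitive structure is well-founded, so Tarski's clauses force the
-- coded satisfaction to be the true one. Hence the coded subsets of `ℓ` are exactly the definable
-- ones (`mem_DefPow_iff`), the coded levels are the true levels (`LAxioms.lev_spec`), and the model
-- is some `L_α[A]` (`LAxioms.eq_LL`). These codes are never pairs of ordinals, so `A` can also
-- enumerate `𝒫(ρ)`. Although `A` describes structures that mention `A`, each instance refers only
-- to sets of smaller rank, so `A` exists by recursion on rank (`exists_predicate`, `exists_model`).
--
-- Let `j` embed such a model into a transitive `N`. If `j` moves an ordinal `≤ ρ`, its critical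
-- point `κ` is `≤ ρ`. All subsets of `κ`, and all functions from `κ` to smaller ordinals, are coded
-- in the model, so `{Y ⊆ κ : κ ∈ j(Y)}` is a genuine non-principal `κ`-complete ultrafilter
-- (`isMeasurableCardinal_of_isCrit`). If `j` fixes every ordinal `≤ ρ`, then each ordinal of `N`
-- codes a subset of `ρ` already listed in the model, so `j` is onto the ordinals of `N`. It then
-- fixes every ordinal, hence every level and every set (`isTrivial_of_fixes_ordinals`). For `H(ρ⁺)`
-- the same dichotomy works, because each of its elements is enumerated by ordinals below `ρ` inside
-- the structure (`measurableCrit_HH`).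
--
-- Conversely, the ultrapower by a measure on `κ` embeds non-trivially every transitive set
-- containing `κ`, so a maximal model has height at most `κ` (`not_isMaximal_of_measurable`). For
-- infinite `ρ` below all measurables there is a maximal model whose height has cardinality `2^ρ >
-- ρ`. The spectrum is therefore cofinal in the least measurable, or in the ordinals if there is
-- none.

universe w w'

namespace TransSpectra

open FirstOrder FirstOrder.Language

/-! ### Calculus of uniformly definable relations -/

section UniformDefinability

variable {L : FirstOrder.Language.{w, w'}} {ι : Type*} {S : ι → Type*} [∀ i, L.Structure (S i)]

/-- A family of relations on the structures `S i` that is defined by one and the same formula. -/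
def UDef (L : FirstOrder.Language.{w, w'}) {ι : Type*} (S : ι → Type*) [∀ i, L.Structure (S i)]
    (P : ∀ i, (ℕ → S i) → Prop) : Prop :=
  ∃ φ : L.Formula ℕ, ∀ i v, φ.Realize v ↔ P i v

/-- Prepend an element to an assignment. -/
def scons {M : Type*} (x : M) (v : ℕ → M) : ℕ → M
  | 0 => x
  | k + 1 => v k

namespace UDef

variable {P Q : ∀ i, (ℕ → S i) → Prop}

lemma congr (h : UDef L S P) (hPQ : ∀ i v, Q i v ↔ P i v) : UDef L S Q := by
  obtain ⟨φ, hφ⟩ := h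
  exact ⟨φ, fun i v => (hφ i v).trans (hPQ i v).symm⟩

lemma const (p : Prop) : UDef L S (fun _ _ => p) := by
  by_cases hp : p
  · exact ⟨⊤, fun i v => by simp [hp]⟩
  · exact ⟨⊥, fun i v => by simp [hp]⟩

lemma not (h : UDef L S P) : UDef L S (fun i v => ¬ P i v) := by
  obtain ⟨φ, hφ⟩ := h
  exact ⟨φ.not, fun i v => by rw [Formula.realize_not, hφ]⟩

lemma and (hP : UDef L S P) (hQ : UDef L S Q) : UDef L S (fun i v => P i v ∧ Q i v) := by
  obtain ⟨φ, hφ⟩ := hP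
  obtain ⟨ψ, hψ⟩ := hQ
  exact ⟨φ ⊓ ψ, fun i v => by rw [Formula.realize_inf, hφ, hψ]⟩

lemma imp (hP : UDef L S P) (hQ : UDef L S Q) : UDef L S (fun i v => P i v → Q i v) :=
  (hP.and hQ.not).not.congr fun i v => by tauto

lemma or (hP : UDef L S P) (hQ : UDef L S Q) : UDef L S (fun i v => P i v ∨ Q i v) :=
  (hP.not.and hQ.not).not.congr fun i v => by tauto

lemma iff (hP : UDef L S P) (hQ : UDef L S Q) : UDef L S (fun i v => P i v ↔ Q i v) :=
  ((hP.imp hQ).and (hQ.imp hP)).congr fun i v => by tauto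

lemma comp (hP : UDef L S P) (f : ℕ → ℕ) : UDef L S (fun i v => P i (fun k => v (f k))) := by
  obtain ⟨φ, hφ⟩ := hP
  exact ⟨φ.relabel f, fun i v => by rw [Formula.realize_relabel, hφ]; rfl⟩

/-- Slot 0 of the assignment holds the quantified element and all older variables move up by one.
The numerals in the later definability proofs count binders in this way. -/
lemma ex {R : ∀ i, S i → (ℕ → S i) → Prop}
    (h : UDef L S (fun i v => R i (v 0) (fun k => v (k + 1)))) :
    UDef L S (fun i v => ∃ x, R i x v) := by
  obtain ⟨φ, hφ⟩ := h
  let g : ℕ → ℕ ⊕ Fin 1 := fun k => k.casesOn (Sum.inr 0) Sum.inl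
  refine ⟨(φ.relabel g).iExs (Fin 1), fun i v => ?_⟩
  rw [Formula.realize_iExs]
  have key : ∀ w : Fin 1 → S i, (Sum.elim v w) ∘ g = scons (w 0) v := by
    intro w; funext k; cases k <;> rfl
  constructor
  · rintro ⟨w, hw⟩
    rw [Formula.realize_relabel, key, hφ] at hw
    exact ⟨w 0, hw⟩
  · rintro ⟨x, hx⟩
    refine ⟨fun _ => x, ?_⟩
    rw [Formula.realize_relabel, key, hφ]
    exact hx

lemma all {R : ∀ i, S i → (ℕ → S i) → Prop}
    (h : UDef L S (fun i v => R i (v 0) (fun k => v (k + 1)))) :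
    UDef L S (fun i v => ∀ x, R i x v) := by
  have h1 : UDef L S (fun i v => ∃ x, ¬ R i x v) := ex h.not
  exact h1.not.congr fun i v => by push Not; rfl

lemma exFin {m : ℕ} {R : Fin m → ∀ i, (ℕ → S i) → Prop} (h : ∀ k, UDef L S (R k)) :
    UDef L S (fun i v => ∃ k, R k i v) := by
  induction m with
  | zero => exact (const False).congr fun i v => by simp
  | succ m ih =>
    exact ((h 0).or (ih fun k => h k.succ)).congr fun i v => by rw [Fin.exists_fin_succ]

/-- All free variables are merged into one, which is then quantified. For a relation that ignores
its assignment, this yields its truth together with non-emptiness of the structure. -/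
lemma sentence (h : UDef L S P) : ∃ σ : L.Sentence, ∀ i, S i ⊨ σ ↔ ∃ x, P i (fun _ => x) := by
  obtain ⟨φ, hφ⟩ := h
  refine ⟨(φ.relabel fun _ => (Sum.inr 0 : Empty ⊕ Fin 1)).iExs (Fin 1), fun i => ?_⟩
  rw [Sentence.Realize, Formula.realize_iExs]
  constructor
  · rintro ⟨w, hw⟩
    rw [Formula.realize_relabel, hφ] at hw
    exact ⟨w 0, hw⟩
  · rintro ⟨x, hx⟩
    refine ⟨fun _ => x, ?_⟩
    rw [Formula.realize_relabel, hφ]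
    exact hx

end UDef

end UniformDefinability

/-! ### Relations that are uniformly definable in a class of set structures -/

/-- A relation on the structures in the class `C` that is defined by one formula of `lang`. -/
abbrev FO (C : SetStr.{u} → Prop) (P : ∀ M : {M : SetStr.{u} // C M}, (ℕ → M.1.Dom) → Prop) : Prop :=
  UDef lang (fun M : {M : SetStr.{u} // C M} => M.1.Dom) P

lemma UDef.mem {C : SetStr.{u} → Prop} (a b : ℕ) : FO C fun _ v => (v a).1 ∈ (v b).1 :=
  ⟨Relations.formula (L := lang) SetRel.mem ![Term.var a, Term.var b], fun M v => by
    rw [Formula.realize_rel]; rfl⟩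

lemma UDef.pred {C : SetStr.{u} → Prop} (a : ℕ) : FO C fun M v => (v a).1 ∈ M.1.A :=
  ⟨Relations.formula (L := lang) SetRel.pred ![Term.var a], fun M v => by
    rw [Formula.realize_rel]; rfl⟩

lemma UDef.eq {C : SetStr.{u} → Prop} (a b : ℕ) : FO C fun _ v => (v a).1 = (v b).1 :=
  ⟨Term.equal (L := lang) (Term.var a) (Term.var b), fun M v => by
    rw [Formula.realize_equal]; exact Subtype.ext_iff⟩

/-- Elementary embeddings preserve uniformly definable relations. -/
lemma UDef.elem {C : SetStr.{u} → Prop}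
    {P : ∀ M : {M : SetStr.{u} // C M}, (ℕ → M.1.Dom) → Prop} (hP : FO C P)
    {M N : SetStr.{u}} (hM : C M) (hN : C N) (j : M.ElemEmb N) (v : ℕ → M.Dom) :
    P ⟨N, hN⟩ (fun k => j (v k)) ↔ P ⟨M, hM⟩ v := by
  obtain ⟨φ, hφ⟩ := hP
  rw [← hφ ⟨M, hM⟩, ← hφ ⟨N, hN⟩]
  exact j.map_formula φ v

end TransSpectra

/-! ### Definable terms and bounded quantifiers over transitive structures -/

namespace TransSpectra

open FirstOrder FirstOrder.Language

/-- Transitive structures that contain `∅` and are closed under `(x, y) ↦ y ∪ {x}`. -/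
structure InsertClosed (M : SetStr.{u}) : Prop where
  trans : M.Transitive
  empty : ∅ ∈ M.X
  insert : ∀ {x y}, x ∈ M.X → y ∈ M.X → insert x y ∈ M.X

lemma zpair_eq (x y : ZFSet.{u}) :
    ZFSet.pair x y = insert (insert x ∅) (insert (insert x (insert y ∅)) ∅) := by
  simp [ZFSet.pair]

namespace InsertClosed

variable {M : SetStr.{u}} (hM : InsertClosed M)
include hM

lemma pair {x y : ZFSet.{u}} (hx : x ∈ M.X) (hy : y ∈ M.X) : ZFSet.pair x y ∈ M.X := by
  rw [zpair_eq]
  have := hM.empty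
  exact hM.insert (hM.insert hx this) (hM.insert (hM.insert hx (hM.insert hy this)) this)

lemma of_pair {x y : ZFSet.{u}} (h : ZFSet.pair x y ∈ M.X) : x ∈ M.X ∧ y ∈ M.X := by
  have h1 : ({x, y} : ZFSet) ∈ M.X := hM.trans.mem_trans (by simp [ZFSet.pair]) h
  exact ⟨hM.trans.mem_trans (by simp) h1, hM.trans.mem_trans (by simp) h1⟩

end InsertClosed

section Terms

variable {C : SetStr.{u} → Prop}

/-- A definable operation with values in the structure. -/
def FOTerm (C : SetStr.{u} → Prop)
    (t : ∀ M : {M : SetStr.{u} // C M}, (ℕ → M.1.Dom) → ZFSet.{u}) : Prop :=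
  (∀ M v, t M v ∈ M.1.X) ∧ FO C fun M v => (v 0).1 = t M fun k => v (k + 1)

namespace UDef

lemma exX {R : ∀ M : {M : SetStr.{u} // C M}, ZFSet.{u} → (ℕ → M.1.Dom) → Prop}
    (h : FO C fun M v => R M (v 0).1 fun k => v (k + 1)) :
    FO C fun M v => ∃ x ∈ M.1.X, R M x v :=
  (UDef.ex (R := fun M x v => R M x.1 v) h).congr fun _ _ =>
    ⟨fun ⟨x, hx, hR⟩ => ⟨⟨x, hx⟩, hR⟩, fun ⟨x, hR⟩ => ⟨x.1, x.2, hR⟩⟩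

lemma allX {R : ∀ M : {M : SetStr.{u} // C M}, ZFSet.{u} → (ℕ → M.1.Dom) → Prop}
    (h : FO C fun M v => R M (v 0).1 fun k => v (k + 1)) :
    FO C fun M v => ∀ x ∈ M.1.X, R M x v :=
  (UDef.all (R := fun M x v => R M x.1 v) h).congr fun _ _ =>
    ⟨fun H x => H x.1 x.2, fun H x hx => H ⟨x, hx⟩⟩

/-- The value of a definable term lies in the structure, so it can be quantified over. This lets
pairs and labels occur in formulas of a language without function symbols. -/
lemma subst {R : ∀ M : {M : SetStr.{u} // C M}, ZFSet.{u} → (ℕ → M.1.Dom) → Prop}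
    {t : ∀ M : {M : SetStr.{u} // C M}, (ℕ → M.1.Dom) → ZFSet.{u}} (ht : FOTerm C t)
    (h : FO C fun M v => R M (v 0).1 fun k => v (k + 1)) : FO C fun M v => R M (t M v) v :=
  (UDef.ex (R := fun M x v => x.1 = t M v ∧ R M x.1 v) (ht.2.and h)).congr fun M v =>
    ⟨fun H => ⟨⟨_, ht.1 M v⟩, rfl, H⟩, fun ⟨_, hx, hR⟩ => hx ▸ hR⟩

end UDef

lemma FOTerm.var (a : ℕ) : FOTerm C fun _ v => (v a).1 :=
  ⟨fun _ v => (v a).2, UDef.eq 0 (a + 1)⟩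

lemma FOTerm.comp {t : ∀ M : {M : SetStr.{u} // C M}, (ℕ → M.1.Dom) → ZFSet.{u}}
    (ht : FOTerm C t) (f : ℕ → ℕ) : FOTerm C fun M v => t M fun k => v (f k) := by
  refine ⟨fun M v => ht.1 _ _, ?_⟩
  let g : ℕ → ℕ := fun k => k.casesOn 0 fun k => f k + 1
  exact ht.2.comp g

variable {s t : ∀ M : {M : SetStr.{u} // C M}, (ℕ → M.1.Dom) → ZFSet.{u}}

lemma UDef.memT (hs : FOTerm C s) (ht : FOTerm C t) : FO C fun M v => s M v ∈ t M v := by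
  refine UDef.subst (R := fun M x v => x ∈ t M v) hs ?_
  exact UDef.subst (R := fun M x v => (v 0).1 ∈ x) (ht.comp (· + 1)) (UDef.mem 1 0)

lemma UDef.eqT (hs : FOTerm C s) (ht : FOTerm C t) : FO C fun M v => s M v = t M v := by
  refine UDef.subst (R := fun M x v => x = t M v) hs ?_
  exact UDef.subst (R := fun M x v => (v 0).1 = x) (ht.comp (· + 1)) (UDef.eq 1 0)

lemma UDef.predT (ht : FOTerm C t) : FO C fun M v => t M v ∈ M.1.A :=
  UDef.subst (R := fun M x _ => x ∈ M.1.A) ht (UDef.pred 0)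

section Transitive

variable (hC : ∀ M, C M → M.Transitive)
include hC

lemma UDef.ball {R : ∀ M : {M : SetStr.{u} // C M}, ZFSet.{u} → (ℕ → M.1.Dom) → Prop}
    (ht : FOTerm C t) (h : FO C fun M v => R M (v 0).1 fun k => v (k + 1)) :
    FO C fun M v => ∀ x ∈ t M v, R M x v :=
  (UDef.allX (R := fun M x v => x ∈ t M v → R M x v)
    ((UDef.memT (.var 0) (ht.comp (· + 1))).imp h)).congr fun M v =>
    ⟨fun H x _ hx => H x hx, fun H x hx => H x ((hC _ M.2).mem_trans hx (ht.1 M v)) hx⟩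

lemma UDef.bex {R : ∀ M : {M : SetStr.{u} // C M}, ZFSet.{u} → (ℕ → M.1.Dom) → Prop}
    (ht : FOTerm C t) (h : FO C fun M v => R M (v 0).1 fun k => v (k + 1)) :
    FO C fun M v => ∃ x ∈ t M v, R M x v :=
  (UDef.exX (R := fun M x v => x ∈ t M v ∧ R M x v)
    ((UDef.memT (.var 0) (ht.comp (· + 1))).and h)).congr fun M v =>
    ⟨fun ⟨x, hx, H⟩ => ⟨x, (hC _ M.2).mem_trans hx (ht.1 M v), hx, H⟩,
      fun ⟨x, _, hx, H⟩ => ⟨x, hx, H⟩⟩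

/-- An ordinal is a transitive set of transitive sets. This is a Δ₀ condition, so transitive
structures evaluate it correctly. -/
lemma UDef.isOrdinal (ht : FOTerm C t) : FO C fun M v => (t M v).IsOrdinal := by
  refine UDef.subst (R := fun M x _ => x.IsOrdinal) ht ?_
  have h1 : FO C fun M v => (∀ y ∈ (v 0).1, ∀ z ∈ y, z ∈ (v 0).1) ∧
      ∀ y ∈ (v 0).1, ∀ z ∈ y, ∀ w ∈ z, w ∈ y := by
    refine .and (UDef.ball hC (.var 0) (UDef.ball hC (.var 0) (UDef.mem 0 2)))
      (UDef.ball hC (.var 0) (UDef.ball hC (.var 0) (UDef.ball hC (.var 0) (UDef.mem 0 2))))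
  exact h1.congr fun M v => ZFSet.isOrdinal_iff_forall_mem_isTransitive

/-- The graph of `insert` is definable over transitive structures. -/
lemma UDef.eq_insert (a b c : ℕ) : FO C fun _ v => (v a).1 = insert (v b).1 (v c).1 := by
  have h1 : FO C fun M v => (∀ z ∈ (v a).1, z = (v b).1 ∨ z ∈ (v c).1) ∧
      (v b).1 ∈ (v a).1 ∧ ∀ z ∈ (v c).1, z ∈ (v a).1 :=
    .and (UDef.ball hC (.var a) ((UDef.eq 0 (b + 1)).or (UDef.mem 0 (c + 1))))
      ((UDef.mem b a).and (UDef.ball hC (.var c) (UDef.mem 0 (a + 1))))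
  refine h1.congr fun M v => ?_
  constructor
  · rintro h
    rw [h]
    simp +contextual
  · rintro ⟨h1, h2, h3⟩
    ext z
    rw [ZFSet.mem_insert_iff]
    exact ⟨h1 z, fun h => h.elim (fun h => h ▸ h2) (h3 z)⟩

end Transitive

section InsertClosed

variable (hC : ∀ M, C M → InsertClosed M)
include hC

lemma FOTerm.empty : FOTerm C fun _ _ => ∅ := by
  refine ⟨fun M _ => (hC _ M.2).empty, ?_⟩
  have h1 : FO C fun M v => ∀ z ∈ (v 0).1, False :=
    UDef.ball (fun M h => (hC M h).trans) (.var 0) (.const False)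
  exact h1.congr fun M v => ZFSet.eq_empty _

lemma FOTerm.insert (hs : FOTerm C s) (ht : FOTerm C t) :
    FOTerm C fun M v => insert (s M v) (t M v) := by
  refine ⟨fun M v => (hC _ M.2).insert (hs.1 M v) (ht.1 M v), ?_⟩
  refine UDef.subst (R := fun M x v => (v 0).1 = Insert.insert x (t M fun k => v (k + 1)))
    (hs.comp (· + 1)) ?_
  refine UDef.subst (R := fun M x v => (v 1).1 = Insert.insert (v 0).1 x) (ht.comp (· + 2)) ?_
  exact UDef.eq_insert (fun M h => (hC M h).trans) 2 1 0

lemma FOTerm.pair (hs : FOTerm C s) (ht : FOTerm C t) :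
    FOTerm C fun M v => ZFSet.pair (s M v) (t M v) := by
  simp only [zpair_eq]
  have h0 := FOTerm.empty hC
  exact .insert hC (.insert hC hs h0) (.insert hC (.insert hC hs (.insert hC ht h0)) h0)

end InsertClosed

end Terms

/-! ### Codes -/

/-- Zermelo's numerals. -/
def num : ℕ → ZFSet.{u}
  | 0 => ∅
  | k + 1 => {num k}

lemma num_injective : Function.Injective num.{u} := by
  intro a
  induction a with
  | zero =>
    rintro (_ | b) h
    · rfl
    · exact absurd ((ZFSet.eq_empty _).1 h.symm (num b)) (by simp [num])
  | succ a ih =>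
    rintro (_ | b) h
    · exact absurd ((ZFSet.eq_empty _).1 h (num a)) (by simp [num])
    · rw [ih (ZFSet.singleton_injective h)]

/-- `tag k x` is `x` with the label `k`. -/
noncomputable def tag (k : ℕ) (x : ZFSet.{u}) : ZFSet.{u} := ZFSet.pair (num k) x

/-- The triple of the label `k` and the sets `x` and `y`. -/
noncomputable def code3 (k : ℕ) (x y : ZFSet.{u}) : ZFSet.{u} := tag k (ZFSet.pair x y)

/-- The triple of the label `k` and the sets `x` and `y`, in a form that is never a pair of
ordinals. -/
noncomputable def tup (k : ℕ) (x y : ZFSet.{u}) : ZFSet.{u} := ZFSet.pair (tag k x) y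

@[simp] lemma tag_inj {k l : ℕ} {x y : ZFSet.{u}} : tag k x = tag l y ↔ k = l ∧ x = y := by
  simp [tag, num_injective.eq_iff]

@[simp] lemma code3_inj {k l : ℕ} {x y x' y' : ZFSet.{u}} :
    code3 k x y = code3 l x' y' ↔ k = l ∧ x = x' ∧ y = y' := by
  simp [code3]

@[simp] lemma tup_inj {k l : ℕ} {x y x' y' : ZFSet.{u}} :
    tup k x y = tup l x' y' ↔ (k = l ∧ x = x') ∧ y = y' := by
  simp [tup]

@[simp] lemma tag_ne_code3 {k l : ℕ} (h : k ≠ l) {x y z : ZFSet.{u}} : tag k x ≠ code3 l y z := by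
  simp [code3, h]

lemma rank_lt_pair_left (x y : ZFSet.{u}) : x.rank < (ZFSet.pair x y).rank :=
  (ZFSet.rank_lt_of_mem (show x ∈ ({x} : ZFSet) by simp)).trans
    (ZFSet.rank_lt_of_mem (by simp [ZFSet.pair]))

lemma rank_lt_pair_right (x y : ZFSet.{u}) : y.rank < (ZFSet.pair x y).rank :=
  (ZFSet.rank_lt_of_mem (show y ∈ ({x, y} : ZFSet) by simp)).trans
    (ZFSet.rank_lt_of_mem (by simp [ZFSet.pair]))

lemma rank_lt_code3_left (k : ℕ) (x y : ZFSet.{u}) : x.rank < (code3 k x y).rank :=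
  (rank_lt_pair_left _ _).trans (rank_lt_pair_right _ _)

lemma rank_lt_code3_right (k : ℕ) (x y : ZFSet.{u}) : y.rank < (code3 k x y).rank :=
  (rank_lt_pair_right _ _).trans (rank_lt_pair_right _ _)

lemma rank_lt_tup_left (k : ℕ) (x y : ZFSet.{u}) : x.rank < (tup k x y).rank :=
  (rank_lt_pair_right _ _).trans (rank_lt_pair_left _ _)

namespace InsertClosed

variable {M : SetStr.{u}} (hM : InsertClosed M)
include hM

lemma num (k : ℕ) : num k ∈ M.X := by
  induction k with
  | zero => exact hM.empty
  | succ k ih =>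
    have := hM.insert ih hM.empty
    rwa [insert_empty_eq] at this

lemma tag {x : ZFSet.{u}} (k : ℕ) (hx : x ∈ M.X) : tag k x ∈ M.X := hM.pair (hM.num k) hx

lemma code3 {x y : ZFSet.{u}} (k : ℕ) (hx : x ∈ M.X) (hy : y ∈ M.X) : code3 k x y ∈ M.X :=
  hM.tag k (hM.pair hx hy)

lemma of_tag {k : ℕ} {x : ZFSet.{u}} (h : TransSpectra.tag k x ∈ M.X) : x ∈ M.X :=
  (hM.of_pair h).2

lemma of_code3 {k : ℕ} {x y : ZFSet.{u}} (h : TransSpectra.code3 k x y ∈ M.X) :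
    x ∈ M.X ∧ y ∈ M.X :=
  hM.of_pair (hM.of_tag h)

end InsertClosed

section CodeTerms

variable {C : SetStr.{u} → Prop} (hC : ∀ M, C M → InsertClosed M)
  {s t : ∀ M : {M : SetStr.{u} // C M}, (ℕ → M.1.Dom) → ZFSet.{u}}
include hC

lemma FOTerm.num (k : ℕ) : FOTerm C fun _ _ => num k := by
  induction k with
  | zero => exact .empty hC
  | succ k ih =>
    have h := FOTerm.insert hC ih (.empty hC)
    simp only [insert_empty_eq] at h
    exact h

lemma FOTerm.tag (k : ℕ) (hs : FOTerm C s) : FOTerm C fun M v => tag k (s M v) :=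
  .pair hC (.num hC k) hs

lemma FOTerm.code3 (k : ℕ) (hs : FOTerm C s) (ht : FOTerm C t) :
    FOTerm C fun M v => code3 k (s M v) (t M v) :=
  .tag hC k (.pair hC hs ht)

lemma FOTerm.tup (k : ℕ) (hs : FOTerm C s) (ht : FOTerm C t) :
    FOTerm C fun M v => tup k (s M v) (t M v) :=
  .pair hC (.tag hC k hs) ht

end CodeTerms

end TransSpectra

namespace TransSpectra

open FirstOrder FirstOrder.Language

/-! ### Satisfaction and levels as parts of the predicate -/

/-- The name of the `k`-th variable. -/
noncomputable def varName (k : ℕ) : ZFSet.{u} := tag 1 (num k)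

/-- The term `t` has the value `a` under the assignment `s`; a term is a variable or the
name `tag 0 a` of the element `a`. -/
def Val (s t a : ZFSet.{u}) : Prop := ZFSet.pair t a ∈ s ∨ t = tag 0 a

/-- Tarski's clauses: what the truth of the formula coded by `e` in `(ℓ, ∈, A)` under the
assignment `s` amounts to, if `R` is the satisfaction relation for the immediate subformulas. -/
def SatClause (A : Set ZFSet.{u}) (R : ZFSet.{u} → ZFSet.{u} → Prop) (ℓ e s : ZFSet.{u}) : Prop :=
  (∃ t u, e = code3 0 t u ∧ ∃ a ∈ ℓ, ∃ b ∈ ℓ, Val s t a ∧ Val s u b ∧ a ∈ b) ∨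
  (∃ t u, e = code3 1 t u ∧ ∃ a ∈ ℓ, ∃ b ∈ ℓ, Val s t a ∧ Val s u b ∧ a = b) ∨
  (∃ t, e = tag 2 t ∧ ∃ a ∈ ℓ, Val s t a ∧ a ∈ A) ∨
  (∃ e₁ e₂, e = code3 3 e₁ e₂ ∧ (R e₁ s → R e₂ s)) ∨
  ∃ n e₁, e = code3 4 n e₁ ∧ ∀ a ∈ ℓ, R e₁ (insert (ZFSet.pair n a) s)

/-- `A` says that `(ℓ, ∈, A)` satisfies `e` under the assignment `s`. -/
def SatIn (A : Set ZFSet.{u}) (ℓ e s : ZFSet.{u}) : Prop := tup 0 ℓ (ZFSet.pair e s) ∈ A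

/-- `A` says that `x` belongs to the level of index `b`. -/
def LevIn (A : Set ZFSet.{u}) (b x : ZFSet.{u}) : Prop := tup 1 b x ∈ A

/-- `A` says that the pairing function on `δ` maps `(a, b)` to `c`. -/
def PairIn (A : Set ZFSet.{u}) (δ a b c : ZFSet.{u}) : Prop :=
  tup 2 δ (ZFSet.pair (ZFSet.pair a b) c) ∈ A

/-- The assignment that maps only the variable `0`, to `z`. -/
noncomputable def asg (z : ZFSet.{u}) : ZFSet.{u} := insert (ZFSet.pair (varName 0) z) ∅

/-- The subset of `ℓ` that is defined by `e` according to `A`. -/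
noncomputable def subOf (A : Set ZFSet.{u}) (ℓ e : ZFSet.{u}) : ZFSet.{u} :=
  ℓ.sep fun z => SatIn A ℓ e (asg z)

/-- The axioms of our theory: `A` consists of a satisfaction predicate, the hierarchy of the
`L_β[A]`, and pairing functions, and the universe is `L[A]`. -/
structure LAxioms (M : SetStr.{u}) : Prop where
  sat : ∀ ℓ ∈ M.X, ∀ e ∈ M.X, ∀ s ∈ M.X, SatIn M.A ℓ e s ↔ SatClause M.A (SatIn M.A ℓ) ℓ e s
  sub : ∀ ℓ ∈ M.X, ∀ e ∈ M.X, subOf M.A ℓ e ∈ M.X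
  lev : ∀ b ∈ M.X, b.IsOrdinal → ∃ ℓ ∈ M.X, ∀ z ∈ M.X, z ∈ ℓ ↔ LevIn M.A b z
  lev_iff : ∀ b ∈ M.X, b.IsOrdinal → ∀ x ∈ M.X, LevIn M.A b x ↔
    ∃ c ∈ b, ∃ ℓ ∈ M.X, (∀ z ∈ M.X, z ∈ ℓ ↔ LevIn M.A c z) ∧ ∃ e ∈ M.X, x = subOf M.A ℓ e
  exists_lev : ∀ x ∈ M.X, ∃ b ∈ M.X, b.IsOrdinal ∧ LevIn M.A b x
  pairing : ∀ δ ∈ M.X, ∅ ∈ δ → (∀ a ∈ δ, insert a a ∈ δ) →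
    (∀ a ∈ δ, ∀ b ∈ δ, ∃ c ∈ δ, PairIn M.A δ a b c) ∧
    ∀ a ∈ δ, ∀ b ∈ δ, ∀ a' ∈ δ, ∀ b' ∈ δ, ∀ c ∈ δ,
      PairIn M.A δ a b c → PairIn M.A δ a' b' c → a = a' ∧ b = b'

section Definability

variable {C : SetStr.{u} → Prop} (hC : ∀ M, C M → InsertClosed M)
  {t₁ t₂ t₃ t₄ : ∀ M : {M : SetStr.{u} // C M}, (ℕ → M.1.Dom) → ZFSet.{u}}
include hC

lemma UDef.val (h₁ : FOTerm C t₁) (h₂ : FOTerm C t₂) (h₃ : FOTerm C t₃) :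
    FO C fun M v => Val (t₁ M v) (t₂ M v) (t₃ M v) :=
  .or (.memT (.pair hC h₂ h₃) h₁) (.eqT h₂ (.tag hC 0 h₃))

lemma UDef.satIn (h₁ : FOTerm C t₁) (h₂ : FOTerm C t₂) (h₃ : FOTerm C t₃) :
    FO C fun M v => SatIn M.1.A (t₁ M v) (t₂ M v) (t₃ M v) :=
  .predT (.tup hC 0 h₁ (.pair hC h₂ h₃))

lemma UDef.levIn (h₁ : FOTerm C t₁) (h₂ : FOTerm C t₂) :
    FO C fun M v => LevIn M.1.A (t₁ M v) (t₂ M v) :=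
  .predT (.tup hC 1 h₁ h₂)

lemma UDef.pairIn (h₁ : FOTerm C t₁) (h₂ : FOTerm C t₂) (h₃ : FOTerm C t₃) (h₄ : FOTerm C t₄) :
    FO C fun M v => PairIn M.1.A (t₁ M v) (t₂ M v) (t₃ M v) (t₄ M v) :=
  .predT (.tup hC 2 h₁ (.pair hC (.pair hC h₂ h₃) h₄))

lemma FOTerm.asg (h : FOTerm C t₁) : FOTerm C fun M v => asg (t₁ M v) :=
  .insert hC (.pair hC (.tag hC 1 (.num hC 0)) h) (.empty hC)

/-- The components of a code belong to its transitive closure, so the quantifiers over codes in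
`SatClause` may be relativized to the structure. Slots 0, 1, 2 hold the assignment, the code and the
set `ℓ`. -/
lemma UDef.satClause : FO C fun M v =>
    SatClause M.1.A (SatIn M.1.A (v 2).1) (v 2).1 (v 1).1 (v 0).1 := by
  have hT := fun M h => (hC M h).trans
  have h : FO C fun M v =>
      (∃ t ∈ M.1.X, ∃ u ∈ M.1.X, (v 1).1 = code3 0 t u ∧
        ∃ a ∈ (v 2).1, ∃ b ∈ (v 2).1, Val (v 0).1 t a ∧ Val (v 0).1 u b ∧ a ∈ b) ∨
      (∃ t ∈ M.1.X, ∃ u ∈ M.1.X, (v 1).1 = code3 1 t u ∧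
        ∃ a ∈ (v 2).1, ∃ b ∈ (v 2).1, Val (v 0).1 t a ∧ Val (v 0).1 u b ∧ a = b) ∨
      (∃ t ∈ M.1.X, (v 1).1 = tag 2 t ∧ ∃ a ∈ (v 2).1, Val (v 0).1 t a ∧ a ∈ M.1.A) ∨
      (∃ e₁ ∈ M.1.X, ∃ e₂ ∈ M.1.X, (v 1).1 = code3 3 e₁ e₂ ∧
        (SatIn M.1.A (v 2).1 e₁ (v 0).1 → SatIn M.1.A (v 2).1 e₂ (v 0).1)) ∨
      ∃ n ∈ M.1.X, ∃ e₁ ∈ M.1.X, (v 1).1 = code3 4 n e₁ ∧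
        ∀ a ∈ (v 2).1, SatIn M.1.A (v 2).1 e₁ (insert (ZFSet.pair n a) (v 0).1) := by
    refine .or ?_ (.or ?_ (.or ?_ (.or ?_ ?_)))
    · refine .exX (.exX (.and (.eqT (.var 3) (.code3 hC 0 (.var 1) (.var 0)))
        (.bex hT (.var 4) (.bex hT (.var 5) (.and ?_ (.and ?_ (.mem 1 0)))))))
      · exact .val hC (.var 4) (.var 3) (.var 1)
      · exact .val hC (.var 4) (.var 2) (.var 0)
    · refine .exX (.exX (.and (.eqT (.var 3) (.code3 hC 1 (.var 1) (.var 0)))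
        (.bex hT (.var 4) (.bex hT (.var 5) (.and ?_ (.and ?_ (.eq 1 0)))))))
      · exact .val hC (.var 4) (.var 3) (.var 1)
      · exact .val hC (.var 4) (.var 2) (.var 0)
    · refine .exX (.and (.eqT (.var 2) (.tag hC 2 (.var 0)))
        (.bex hT (.var 3) (.and (.val hC (.var 2) (.var 1) (.var 0)) (.pred 0))))
    · exact .exX (.exX (.and (.eqT (.var 3) (.code3 hC 3 (.var 1) (.var 0)))
        (.imp (.satIn hC (.var 4) (.var 1) (.var 2)) (.satIn hC (.var 4) (.var 0) (.var 2)))))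
    · exact .exX (.exX (.and (.eqT (.var 3) (.code3 hC 4 (.var 1) (.var 0)))
        (.ball hT (.var 4) (.satIn hC (.var 5) (.var 1)
          (.insert hC (.pair hC (.var 2) (.var 0)) (.var 3))))))
  refine h.congr fun M v => ?_
  have hM := hC _ M.2
  have key : ∀ k x y, (v 1).1 = code3 k x y → x ∈ M.1.X ∧ y ∈ M.1.X :=
    fun k x y h => hM.of_code3 (h ▸ (v 1).2)
  have key' : ∀ k x, (v 1).1 = tag k x → x ∈ M.1.X := fun k x h => hM.of_tag (h ▸ (v 1).2)
  have h2 : ∀ (k : ℕ) (P : ZFSet.{u} → ZFSet.{u} → Prop), (∃ x y, (v 1).1 = code3 k x y ∧ P x y) ↔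
      ∃ x ∈ M.1.X, ∃ y ∈ M.1.X, (v 1).1 = code3 k x y ∧ P x y := fun k P =>
    ⟨fun ⟨x, y, h, hP⟩ => ⟨x, (key k x y h).1, y, (key k x y h).2, h, hP⟩,
      fun ⟨x, _, y, _, h⟩ => ⟨x, y, h⟩⟩
  have h1 : ∀ (k : ℕ) (P : ZFSet.{u} → Prop), (∃ x, (v 1).1 = tag k x ∧ P x) ↔
      ∃ x ∈ M.1.X, (v 1).1 = tag k x ∧ P x := fun k P =>
    ⟨fun ⟨x, h, hP⟩ => ⟨x, key' k x h, h, hP⟩, fun ⟨x, _, h⟩ => ⟨x, h⟩⟩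
  simp only [SatClause, h2, h1]

lemma UDef.eq_subOf (a b c : ℕ) : FO C fun M v => (v a).1 = subOf M.1.A (v b).1 (v c).1 := by
  have hT := fun M h => (hC M h).trans
  have h : FO C fun M v => ∀ z ∈ M.1.X, z ∈ (v a).1 ↔
      z ∈ (v b).1 ∧ SatIn M.1.A (v b).1 (v c).1 (asg z) :=
    .allX (.iff (.mem 0 (a + 1)) (.and (.mem 0 (b + 1))
      (.satIn hC (.var (b + 1)) (.var (c + 1)) (.asg hC (.var 0)))))
  refine h.congr fun M v => ?_
  rw [ZFSet.ext_iff]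
  simp only [subOf, ZFSet.mem_sep]
  refine ⟨fun h z _ => h z, fun h z => ?_⟩
  by_cases hz : z ∈ M.1.X
  · exact h z hz
  · have h1 : ∀ i, z ∉ (v i).1 := fun i hi => hz ((hT _ M.2).mem_trans hi (v i).2)
    simp [h1]

lemma UDef.lAxioms : FO C fun M _ => LAxioms M.1 := by
  have hT := fun M h => (hC M h).trans
  have h₁ : FO C fun M _ => ∀ ℓ ∈ M.1.X, ∀ e ∈ M.1.X, ∀ s ∈ M.1.X,
      SatIn M.1.A ℓ e s ↔ SatClause M.1.A (SatIn M.1.A ℓ) ℓ e s :=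
    .allX (.allX (.allX (.iff (.satIn hC (.var 2) (.var 1) (.var 0)) (.satClause hC))))
  have h₂ : FO C fun M _ => ∀ ℓ ∈ M.1.X, ∀ e ∈ M.1.X, ∃ x ∈ M.1.X, x = subOf M.1.A ℓ e :=
    .allX (.allX (.exX (.eq_subOf hC 0 2 1)))
  have h₃ : FO C fun M _ => ∀ b ∈ M.1.X, b.IsOrdinal →
      ∃ ℓ ∈ M.1.X, ∀ z ∈ M.1.X, z ∈ ℓ ↔ LevIn M.1.A b z :=
    .allX (.imp (.isOrdinal hT (.var 0))
      (.exX (.allX (.iff (.mem 0 1) (.levIn hC (.var 2) (.var 0))))))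
  have h₄ : FO C fun M _ => ∀ b ∈ M.1.X, b.IsOrdinal → ∀ x ∈ M.1.X, LevIn M.1.A b x ↔
      ∃ c ∈ b, ∃ ℓ ∈ M.1.X, (∀ z ∈ M.1.X, z ∈ ℓ ↔ LevIn M.1.A c z) ∧
        ∃ e ∈ M.1.X, x = subOf M.1.A ℓ e :=
    .allX (.imp (.isOrdinal hT (.var 0)) (.allX (.iff (.levIn hC (.var 1) (.var 0))
      (.bex hT (.var 1) (.exX (.and (.allX (.iff (.mem 0 1) (.levIn hC (.var 2) (.var 0))))
        (.exX (.eq_subOf hC 3 1 0))))))))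
  have h₅ : FO C fun M _ => ∀ x ∈ M.1.X, ∃ b ∈ M.1.X, b.IsOrdinal ∧ LevIn M.1.A b x :=
    .allX (.exX (.and (.isOrdinal hT (.var 0)) (.levIn hC (.var 0) (.var 1))))
  have h₆ : FO C fun M _ => ∀ δ ∈ M.1.X, ∅ ∈ δ → (∀ a ∈ δ, insert a a ∈ δ) →
      (∀ a ∈ δ, ∀ b ∈ δ, ∃ c ∈ δ, PairIn M.1.A δ a b c) ∧
      ∀ a ∈ δ, ∀ b ∈ δ, ∀ a' ∈ δ, ∀ b' ∈ δ, ∀ c ∈ δ,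
        PairIn M.1.A δ a b c → PairIn M.1.A δ a' b' c → a = a' ∧ b = b' := by
    refine .allX (.imp (.memT (.empty hC) (.var 0)) (.imp (.ball hT (.var 0) (.memT
      (.insert hC (.var 0) (.var 0)) (.var 1))) (.and ?_ ?_)))
    · exact .ball hT (.var 0) (.ball hT (.var 1) (.bex hT (.var 2)
        (.pairIn hC (.var 3) (.var 2) (.var 1) (.var 0))))
    · exact .ball hT (.var 0) (.ball hT (.var 1) (.ball hT (.var 2) (.ball hT (.var 3)
        (.ball hT (.var 4) (.imp (.pairIn hC (.var 5) (.var 4) (.var 3) (.var 0))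
          (.imp (.pairIn hC (.var 5) (.var 2) (.var 1) (.var 0))
            (.and (.eq 4 2) (.eq 3 1))))))))
  refine (h₁.and (h₂.and (h₃.and (h₄.and (h₅.and h₆))))).congr fun M v => ?_
  constructor
  · rintro ⟨h₁, h₂, h₃, h₄, h₅, h₆⟩
    exact ⟨h₁, fun ℓ hℓ e he => ⟨_, h₂ ℓ hℓ e he, rfl⟩, h₃, h₄, h₅, h₆⟩
  · rintro ⟨h₁, h₂, h₃, h₄, h₅, h₆⟩
    exact ⟨h₁, fun ℓ hℓ e he => let ⟨x, hx, h⟩ := h₂ ℓ hℓ e he; h ▸ hx, h₃, h₄, h₅, h₆⟩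

end Definability

/-- A single sentence axiomatizes, for transitive structures, closure under `insert` and
`LAxioms`. -/
theorem exists_sentence : ∃ σ : lang.Sentence, ∀ M : SetStr.{u}, M.Transitive →
    (M.Dom ⊨ σ ↔ InsertClosed M ∧ LAxioms M) := by
  -- The terms in `LAxioms` have values only under closure under `insert`, so `σ` is correct only
  -- within that class; `τ` singles out the class among all transitive structures.
  obtain ⟨σ, hσ⟩ := (UDef.lAxioms (C := InsertClosed.{u}) fun _ h => h).sentence
  have h : FO SetStr.Transitive.{u} fun M _ => (∃ x ∈ M.1.X, ∀ y ∈ x, False) ∧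
      ∀ x ∈ M.1.X, ∀ y ∈ M.1.X, ∃ z ∈ M.1.X, z = insert x y :=
    .and (.exX (.ball (fun _ h => h) (.var 0) (.const False)))
      (.allX (.allX (.exX (.eq_insert (fun _ h => h) 0 2 1))))
  obtain ⟨τ, hτ⟩ := h.sentence
  refine ⟨τ ⊓ σ, fun M hM => ?_⟩
  have h1 : M.Dom ⊨ τ ↔ InsertClosed M := by
    refine (hτ ⟨M, hM⟩).trans ⟨?_, fun h => ⟨⟨∅, h.empty⟩, ⟨∅, h.empty, ?_⟩, ?_⟩⟩
    · rintro ⟨-, ⟨x, hx, hx'⟩, h⟩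
      obtain rfl := (ZFSet.eq_empty x).2 hx'
      exact ⟨hM, hx, fun {x y} hx hy => by obtain ⟨z, hz, rfl⟩ := h x hx y hy; exact hz⟩
    · simp
    · exact fun x hx y hy => ⟨_, h.insert hx hy, rfl⟩
  rw [Sentence.Realize, Formula.realize_inf]
  change M.Dom ⊨ τ ∧ M.Dom ⊨ σ ↔ _
  rw [h1]
  refine and_congr_right fun h => (hσ ⟨M, h⟩).trans ⟨fun ⟨_, h⟩ => h, fun h' => ?_⟩
  exact ⟨⟨∅, h.empty⟩, h'⟩

end TransSpectra

namespace TransSpectra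

open FirstOrder FirstOrder.Language

/-! ### Definability with parameters in a single structure -/

/-- Relations that are definable over `(X, ∈, A)` with parameters. -/
abbrev PDef (A : Set ZFSet.{u}) (X : ZFSet.{u}) (P : (ℕ → (SetStr.mk X A).Dom) → Prop) : Prop :=
  UDef (lang[[(Set.univ : Set (SetStr.mk X A).Dom)]]) (fun _ : Unit => (SetStr.mk X A).Dom)
    fun _ => P

variable {A : Set ZFSet.{u}} {X : ZFSet.{u}}

section PDef

variable {P Q : (ℕ → (SetStr.mk X A).Dom) → Prop}

lemma PDef.and (hP : PDef A X P) (hQ : PDef A X Q) : PDef A X fun v => P v ∧ Q v := UDef.and hP hQ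

lemma PDef.or (hP : PDef A X P) (hQ : PDef A X Q) : PDef A X fun v => P v ∨ Q v := UDef.or hP hQ

lemma PDef.imp (hP : PDef A X P) (hQ : PDef A X Q) : PDef A X fun v => P v → Q v := UDef.imp hP hQ

lemma PDef.ex {R : (SetStr.mk X A).Dom → (ℕ → (SetStr.mk X A).Dom) → Prop}
    (h : PDef A X fun v => R (v 0) fun k => v (k + 1)) : PDef A X fun v => ∃ x, R x v :=
  UDef.ex (R := fun _ => R) h

end PDef

lemma mem_DefPow {y : ZFSet.{u}} :
    y ∈ DefPow A X ↔ y ⊆ X ∧ PDef A X fun v => (v 0).1 ∈ y := by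
  rw [DefPow, ZFSet.mem_sep, ZFSet.mem_powerset]
  refine and_congr_right fun _ => ?_
  constructor
  · rintro ⟨φ, hφ⟩
    refine ⟨φ.relabel fun _ => 0, fun _ v => ?_⟩
    rw [Formula.realize_relabel]
    exact (Set.ext_iff.1 hφ fun _ => v 0).symm
  · rintro ⟨φ, hφ⟩
    refine ⟨φ.relabel fun _ => 0, Set.ext fun v => ?_⟩
    have h := Formula.realize_relabel (φ := φ) (g := fun _ => (0 : Fin 1)) (v := v)
    exact (h.trans (hφ () _)).symm

lemma PDef.eq_const (a : ℕ) (c : (SetStr.mk X A).Dom) : PDef A X fun v => v a = c :=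
  ⟨Term.equal (Term.var a) (Constants.term
    (L := lang[[(Set.univ : Set (SetStr.mk X A).Dom)]]) (lang.con ⟨c, Set.mem_univ _⟩)),
    fun _ v => by rw [Formula.realize_equal, Term.realize_constants, Term.realize_var]; rfl⟩

lemma PDef.of_formula (φ : lang.Formula ℕ) : PDef A X fun v => φ.Realize v :=
  ⟨(lang.lhomWithConstants _).onFormula φ, fun _ _ => LHom.realize_onFormula _ _⟩

/-- A uniformly definable relation with some arguments replaced by parameters is definable. -/
lemma PDef.of_FO {C : SetStr.{u} → Prop} {P : ∀ M : {M : SetStr.{u} // C M}, (ℕ → M.1.Dom) → Prop}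
    (hP : FO C P) (hX : C ⟨X, A⟩) (p : ℕ → (SetStr.mk X A).Dom) :
    PDef A X fun v => P ⟨⟨X, A⟩, hX⟩ (scons (v 0) p) := by
  obtain ⟨φ, hφ⟩ := hP
  let f : ℕ → (lang[[(Set.univ : Set (SetStr.mk X A).Dom)]]).Term ℕ := fun k => k.casesOn (Term.var 0)
    fun k => Constants.term
      (L := lang[[(Set.univ : Set (SetStr.mk X A).Dom)]]) (lang.con ⟨p k, Set.mem_univ _⟩)
  refine ⟨BoundedFormula.subst ((lang.lhomWithConstants _).onFormula φ) f, fun _ v => ?_⟩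
  refine Iff.trans ?_ (hφ _ _)
  rw [Formula.Realize, BoundedFormula.realize_subst]
  refine (LHom.realize_onFormula _ _).trans (iff_of_eq (congrArg φ.Realize ?_))
  funext k
  cases k with
  | zero => rfl
  | succ k => exact Term.realize_constants

lemma PDef.mem (a b : ℕ) : PDef A X fun v => (v a).1 ∈ (v b).1 := by
  obtain ⟨φ, hφ⟩ := UDef.mem (C := fun M => M = ⟨X, A⟩) a b
  exact (PDef.of_formula φ).congr fun _ v => (hφ ⟨_, rfl⟩ v).symm

lemma PDef.pred (a : ℕ) : PDef A X fun v => (v a).1 ∈ A := by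
  obtain ⟨φ, hφ⟩ := UDef.pred (C := fun M => M = ⟨X, A⟩) a
  exact (PDef.of_formula φ).congr fun _ v => (hφ ⟨_, rfl⟩ v).symm

lemma PDef.eq (a b : ℕ) : PDef A X fun v => (v a).1 = (v b).1 := by
  obtain ⟨φ, hφ⟩ := UDef.eq (C := fun M => M = ⟨X, A⟩) a b
  exact (PDef.of_formula φ).congr fun _ v => (hφ ⟨_, rfl⟩ v).symm

/-- Subsets of a structure that are defined by uniformly definable relations. -/
lemma mem_DefPow_of_FO {C : SetStr.{u} → Prop}
    {P : ∀ M : {M : SetStr.{u} // C M}, (ℕ → M.1.Dom) → Prop} (hP : FO C P) (hX : C ⟨X, A⟩)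
    (p : ℕ → (SetStr.mk X A).Dom) {y : ZFSet.{u}} (hy : y ⊆ X)
    (h : ∀ z : (SetStr.mk X A).Dom, z.1 ∈ y ↔ P ⟨⟨X, A⟩, hX⟩ (scons z p)) : y ∈ DefPow A X :=
  mem_DefPow.2 ⟨hy, (PDef.of_FO hP hX p).congr fun _ v => h (v 0)⟩

/-- `Def^A(X)` depends only on `A ∩ X`. -/
lemma DefPow_congr {A' : Set ZFSet.{u}} (h : ∀ x ∈ X, x ∈ A ↔ x ∈ A') :
    DefPow A X = DefPow A' X := by
  have key : ∀ (B : Set ZFSet.{u}), DefPow B X = DefPow (B ∩ {x | x ∈ X}) X := by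
    intro B
    have hs : (inferInstance : lang.Structure (SetStr.mk X B).Dom) =
        (inferInstance : lang.Structure (SetStr.mk X (B ∩ {x | x ∈ X})).Dom) := by
      refine Structure.ext (funext fun n => funext fun f => Empty.elim f)
        (funext fun n => funext fun R => funext fun v => ?_)
      cases R with
      | mem => rfl
      | pred => exact propext ⟨fun h => ⟨h, (v 0).2⟩, fun h => h.1⟩
    unfold DefPow
    congr 1
    funext y
    exact congrArg (fun inst : lang.Structure (SetStr.mk X B).Dom =>
      @Set.Definable₁ (SetStr.mk X B).Dom Set.univ lang inst {x | x.1 ∈ y}) hs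
  rw [key A, key A']
  congr 1
  ext x
  exact ⟨fun ⟨h1, h2⟩ => ⟨(h x h2).1 h1, h2⟩, fun ⟨h1, h2⟩ => ⟨(h x h2).2 h1, h2⟩⟩

/-! ### The hierarchy `L_α[A]` -/

lemma mem_LL {α : Ordinal.{u}} {x : ZFSet.{u}} :
    x ∈ LL A α ↔ ∃ β < α, x ∈ DefPow A (LL A β) := by
  rw [LL, ZFSet.mem_iUnion]
  simp

lemma LL_mono {α β : Ordinal.{u}} (h : α ≤ β) : LL A α ⊆ LL A β := fun x hx => by
  obtain ⟨γ, hγ, hx⟩ := mem_LL.1 hx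
  exact mem_LL.2 ⟨γ, hγ.trans_le h, hx⟩

lemma LL_transitive (A : Set ZFSet.{u}) (α : Ordinal.{u}) : (LL A α).IsTransitive := fun x hx => by
  obtain ⟨β, hβ, hx⟩ := mem_LL.1 hx
  exact (mem_DefPow.1 hx).1.trans (LL_mono hβ.le)

lemma rank_lt_of_mem_LL {α : Ordinal.{u}} : ∀ {x : ZFSet.{u}}, x ∈ LL A α → x.rank < α := by
  induction α using WellFoundedLT.induction with
  | ind α ih =>
    intro x hx
    obtain ⟨β, hβ, hx⟩ := mem_LL.1 hx
    exact (ZFSet.rank_le_iff.2 fun y hy => ih β hβ ((mem_DefPow.1 hx).1 hy)).trans_lt hβ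

/-- One direction compares ranks. For the other, by induction the ordinals of `L_o[A]` are exactly
those below `o`, so `o` is defined over `L_o[A]` by the Δ₀ formula for ordinals. -/
lemma toZFSet_mem_LL {o α : Ordinal.{u}} : o.toZFSet ∈ LL A α ↔ o < α := by
  refine ⟨fun h => by simpa using rank_lt_of_mem_LL h, fun h => mem_LL.2 ⟨o, h, ?_⟩⟩
  clear h
  induction o using WellFoundedLT.induction with
  | ind o ih =>
    have hsub : o.toZFSet ⊆ LL A o := fun x hx => by
      obtain ⟨a, ha, rfl⟩ := Ordinal.mem_toZFSet_iff.1 hx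
      exact mem_LL.2 ⟨a, ha, ih a ha⟩
    -- The formula needs no parameters, but a parameter list requires some element to fill it; the
    -- empty level is treated separately.
    by_cases h0 : ∃ z, z ∈ LL A o
    · obtain ⟨z₀, hz₀⟩ := h0
      have hO := UDef.isOrdinal (C := SetStr.Transitive.{u}) (fun _ h => h) (.var 0)
      refine mem_DefPow_of_FO hO (LL_transitive A o) (fun _ => ⟨z₀, hz₀⟩) hsub fun z => ?_
      rw [Ordinal.mem_toZFSet_iff]
      constructor
      · rintro ⟨a, -, ha⟩
        change z.1.IsOrdinal
        exact ha ▸ ZFSet.isOrdinal_toZFSet a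
      · intro (h : z.1.IsOrdinal)
        obtain ⟨a, ha⟩ := ZFSet.isOrdinal_iff_mem_range_toZFSet.1 h
        exact ⟨a, by simpa [← ha] using rank_lt_of_mem_LL z.2, ha⟩
    · push Not at h0
      refine mem_DefPow.2 ⟨hsub, (UDef.const False).congr fun _ v => ?_⟩
      exact (h0 _ (v 0).2).elim

lemma LL_mem_LL {β α : Ordinal.{u}} (h : β < α) : LL A β ∈ LL A α :=
  mem_LL.2 ⟨β, h, mem_DefPow.2 ⟨subset_rfl, (UDef.const True).congr fun _ v =>
    iff_true_intro (v 0).2⟩⟩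

lemma exists_mem_LL_of_isSuccLimit {α : Ordinal.{u}} (hα : Order.IsSuccLimit α) {x : ZFSet.{u}}
    (hx : x ∈ LL A α) : ∃ β < α, x ∈ LL A β := by
  obtain ⟨β, hβ, hx⟩ := mem_LL.1 hx
  exact ⟨β + 1, hα.add_one_lt hβ, mem_LL.2 ⟨β, Order.lt_add_one_iff.2 le_rfl, hx⟩⟩

/-- The construction of `L_α[A]` consults `A` only at elements of earlier levels. -/
lemma LL_congr {A' : Set ZFSet.{u}} {α : Ordinal.{u}} (h : ∀ x ∈ LL A α, x ∈ A ↔ x ∈ A') :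
    LL A α = LL A' α := by
  induction α using WellFoundedLT.induction with
  | ind α ih =>
    have key : ∀ β < α, DefPow A (LL A β) = DefPow A' (LL A' β) := fun β hβ => by
      have hβ' : ∀ x ∈ LL A β, x ∈ A ↔ x ∈ A' := fun x hx => h x (LL_mono hβ.le hx)
      rw [DefPow_congr hβ', ih β hβ hβ']
    ext x
    rw [mem_LL, mem_LL]
    exact exists_congr fun β => and_congr_right fun hβ => by rw [key β hβ]

lemma insertClosed_LStr {α : Ordinal.{u}} (hα : Order.IsSuccLimit α) :
    InsertClosed (LStr A α) where
  trans := LL_transitive A α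
  empty := by
    have := toZFSet_mem_LL (A := A).2 hα.bot_lt
    rwa [show (⊥ : Ordinal) = 0 from rfl, Ordinal.toZFSet_zero] at this
  insert {x y} hx hy := by
    obtain ⟨β, hβ, hx⟩ := exists_mem_LL_of_isSuccLimit hα hx
    obtain ⟨γ, hγ, hy⟩ := exists_mem_LL_of_isSuccLimit hα hy
    have hx' := LL_mono (le_max_left β γ) hx
    have hy' := LL_mono (le_max_right β γ) hy
    refine mem_LL.2 ⟨max β γ, max_lt hβ hγ, ?_⟩
    have h : FO SetStr.Transitive.{u} fun M v => (v 0).1 = (v 1).1 ∨ (v 0).1 ∈ (v 2).1 :=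
      .or (.eq 0 1) (.mem 0 2)
    refine mem_DefPow_of_FO h (LL_transitive A _)
      (scons ⟨x, hx'⟩ fun _ => ⟨y, hy'⟩) ?_ fun z => ZFSet.mem_insert_iff
    intro z hz
    rcases ZFSet.mem_insert_iff.1 hz with rfl | hz
    · exact hx'
    · exact (LL_transitive A _).mem_trans hz hy'

end TransSpectra

namespace TransSpectra

open FirstOrder FirstOrder.Language

/-! ### Definability and the satisfaction predicate -/


variable {M : SetStr.{u}} {ℓ : ZFSet.{u}}

/-- `s` is the assignment that maps `names k` to `v k`. -/
def Assigns {m : ℕ} (s : ZFSet.{u}) (names v : Fin m → ZFSet.{u}) : Prop :=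
  ∀ t a, ZFSet.pair t a ∈ s ↔ ∃ k, t = names k ∧ a = v k

lemma Assigns.insert {m : ℕ} {s : ZFSet.{u}} {names v : Fin m → ZFSet.{u}} (h : Assigns s names v)
    (n a : ZFSet.{u}) :
    Assigns (insert (ZFSet.pair n a) s) (Fin.cons n names : Fin (m + 1) → ZFSet.{u})
      (Fin.cons a v : Fin (m + 1) → ZFSet.{u}) := fun t b => by
  rw [ZFSet.mem_insert_iff, ZFSet.pair_inj, h, Fin.exists_fin_succ]
  simp

lemma assigns_asg (z : ZFSet.{u}) : Assigns (asg z) (fun _ : Fin 1 => varName 0) fun _ => z :=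
  fun t a => by simp [asg]

/-! #### Every code defines a definable set -/

/-- Slot `i` holds the candidate value, and the assigned values start at slot `r`, the number of
binders passed. As `t` and the names are fixed, `t = names k` is a constant proposition. -/
lemma pdef_val {m : ℕ} (names : Fin m → ZFSet.{u}) (t : ZFSet.{u}) (i r : ℕ) :
    PDef M.A ℓ fun v => (∃ k, t = names k ∧ (v i).1 = (v (k + r)).1) ∨ t = tag 0 (v i).1 := by
  refine .or (.exFin fun k => .and (.const _) (PDef.eq _ _)) ?_
  by_cases h : ∃ c : (SetStr.mk ℓ M.A).Dom, t = tag 0 c.1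
  · obtain ⟨c, rfl⟩ := h
    exact (PDef.eq_const i c).congr fun _ v => by
      simp only [tag_inj, true_and]
      exact ⟨fun h => Subtype.ext h.symm, fun h => (congrArg Subtype.val h).symm⟩
  · exact (UDef.const False).congr fun _ v => iff_false_intro fun h' => h ⟨_, h'⟩

variable (hM : InsertClosed M) (ax : ∀ ℓ ∈ M.X, ∀ e ∈ M.X, ∀ s ∈ M.X,
    SatIn M.A ℓ e s ↔ SatClause M.A (SatIn M.A ℓ) ℓ e s) (hℓ : ℓ ∈ M.X)
include hM ax hℓ

/-- Induction on the rank of `e` unfolds Tarski's clauses into an actual formula. Since `e` is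
arbitrary, each clause either matches or contributes falsity. A name may be quantified repeatedly,
in which case the assignment becomes multivalued; this is harmless because the atomic clauses only
ask for some values. -/
lemma pdef_satIn : ∀ {e : ZFSet.{u}}, e ∈ M.X → ∀ {m : ℕ} (names : Fin m → ZFSet.{u}),
    ∃ P : (ℕ → (SetStr.mk ℓ M.A).Dom) → Prop, PDef M.A ℓ P ∧ ∀ v, ∀ s ∈ M.X,
      Assigns s names (fun k => (v k).1) → (SatIn M.A ℓ e s ↔ P v) := by
  intro e
  induction h : e.rank using WellFoundedLT.induction generalizing e with
  | ind o ih =>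
  subst h
  intro he m names
  have hval : ∀ v : ℕ → (SetStr.mk ℓ M.A).Dom, ∀ s, Assigns s names (fun k => (v k).1) →
      ∀ t a, Val s t a ↔ (∃ k : Fin m, t = names k ∧ a = (v k).1) ∨ t = tag 0 a :=
    fun v s hs t a => by rw [Val, hs]
  have h₀ : ∃ P, PDef M.A ℓ P ∧ ∀ v s, Assigns s names (fun k => (v k).1) →
      ((∃ t u, e = code3 0 t u ∧ ∃ a ∈ ℓ, ∃ b ∈ ℓ, Val s t a ∧ Val s u b ∧ a ∈ b) ↔ P v) := by
    by_cases h : ∃ t u, e = code3 0 t u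
    · obtain ⟨t, u, rfl⟩ := h
      refine ⟨_, PDef.ex (R := fun a v => ∃ b : (SetStr.mk ℓ M.A).Dom,
        ((∃ k : Fin m, t = names k ∧ a.1 = (v k).1) ∨ t = tag 0 a.1) ∧
        ((∃ k : Fin m, u = names k ∧ b.1 = (v k).1) ∨ u = tag 0 b.1) ∧ a.1 ∈ b.1)
        (.ex (.and (pdef_val names t 1 2) (.and (pdef_val names u 0 2) (PDef.mem 1 0)))),
        fun v s hs => ?_⟩
      simp only [hval v s hs]
      constructor
      · rintro ⟨t', u', h, a, ha, b, hb, h'⟩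
        obtain ⟨-, rfl, rfl⟩ := code3_inj.1 h
        exact ⟨⟨a, ha⟩, ⟨b, hb⟩, h'⟩
      · rintro ⟨a, b, h⟩
        exact ⟨t, u, rfl, a.1, a.2, b.1, b.2, h⟩
    · exact ⟨_, .const False, fun v s _ => iff_false_intro fun ⟨t, u, h', _⟩ => h ⟨t, u, h'⟩⟩
  have h₁ : ∃ P, PDef M.A ℓ P ∧ ∀ v s, Assigns s names (fun k => (v k).1) →
      ((∃ t u, e = code3 1 t u ∧ ∃ a ∈ ℓ, ∃ b ∈ ℓ, Val s t a ∧ Val s u b ∧ a = b) ↔ P v) := by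
    by_cases h : ∃ t u, e = code3 1 t u
    · obtain ⟨t, u, rfl⟩ := h
      refine ⟨_, PDef.ex (R := fun a v => ∃ b : (SetStr.mk ℓ M.A).Dom,
        ((∃ k : Fin m, t = names k ∧ a.1 = (v k).1) ∨ t = tag 0 a.1) ∧
        ((∃ k : Fin m, u = names k ∧ b.1 = (v k).1) ∨ u = tag 0 b.1) ∧ a.1 = b.1)
        (.ex (.and (pdef_val names t 1 2) (.and (pdef_val names u 0 2) (PDef.eq 1 0)))),
        fun v s hs => ?_⟩
      simp only [hval v s hs]
      constructor
      · rintro ⟨t', u', h, a, ha, b, hb, h'⟩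
        obtain ⟨-, rfl, rfl⟩ := code3_inj.1 h
        exact ⟨⟨a, ha⟩, ⟨b, hb⟩, h'⟩
      · rintro ⟨a, b, h⟩
        exact ⟨t, u, rfl, a.1, a.2, b.1, b.2, h⟩
    · exact ⟨_, .const False, fun v s _ => iff_false_intro fun ⟨t, u, h', _⟩ => h ⟨t, u, h'⟩⟩
  have h₂ : ∃ P, PDef M.A ℓ P ∧ ∀ v s, Assigns s names (fun k => (v k).1) →
      ((∃ t, e = tag 2 t ∧ ∃ a ∈ ℓ, Val s t a ∧ a ∈ M.A) ↔ P v) := by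
    by_cases h : ∃ t, e = tag 2 t
    · obtain ⟨t, rfl⟩ := h
      refine ⟨_, PDef.ex (R := fun a v =>
        ((∃ k : Fin m, t = names k ∧ a.1 = (v k).1) ∨ t = tag 0 a.1) ∧ a.1 ∈ M.A)
        (.and (pdef_val names t 0 1) (PDef.pred 0)), fun v s hs => ?_⟩
      simp only [hval v s hs]
      constructor
      · rintro ⟨t', h, a, ha, h'⟩
        obtain ⟨-, rfl⟩ := tag_inj.1 h
        exact ⟨⟨a, ha⟩, h'⟩
      · rintro ⟨a, h⟩
        exact ⟨t, rfl, a.1, a.2, h⟩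
    · exact ⟨_, .const False, fun v s _ => iff_false_intro fun ⟨t, h', _⟩ => h ⟨t, h'⟩⟩
  have h₃ : ∃ P, PDef M.A ℓ P ∧ ∀ v, ∀ s ∈ M.X, Assigns s names (fun k => (v k).1) →
      ((∃ e₁ e₂, e = code3 3 e₁ e₂ ∧ (SatIn M.A ℓ e₁ s → SatIn M.A ℓ e₂ s)) ↔ P v) := by
    by_cases h : ∃ e₁ e₂, e = code3 3 e₁ e₂
    · obtain ⟨e₁, e₂, rfl⟩ := h
      obtain ⟨P₁, hP₁, h₁⟩ := ih _ (rank_lt_code3_left _ _ _) rfl (hM.of_code3 he).1 names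
      obtain ⟨P₂, hP₂, h₂⟩ := ih _ (rank_lt_code3_right _ _ _) rfl (hM.of_code3 he).2 names
      refine ⟨_, PDef.imp hP₁ hP₂, fun v s hsM hs => ?_⟩
      rw [← h₁ v s hsM hs, ← h₂ v s hsM hs]
      simp
    · exact ⟨_, .const False, fun v s _ _ => iff_false_intro fun ⟨t, u, h', _⟩ => h ⟨t, u, h'⟩⟩
  have h₄ : ∃ P, PDef M.A ℓ P ∧ ∀ v, ∀ s ∈ M.X, Assigns s names (fun k => (v k).1) →
      ((∃ n e₁, e = code3 4 n e₁ ∧ ∀ a ∈ ℓ, SatIn M.A ℓ e₁ (insert (ZFSet.pair n a) s)) ↔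
        P v) := by
    by_cases h : ∃ n e₁, e = code3 4 n e₁
    · obtain ⟨n, e₁, rfl⟩ := h
      obtain ⟨P₁, hP₁, h₁⟩ := ih _ (rank_lt_code3_right _ _ _) rfl (hM.of_code3 he).2
        (Fin.cons n names : Fin (m + 1) → ZFSet.{u})
      refine ⟨fun v => ∀ x, P₁ (scons x v), .all (hP₁.congr fun _ v => ?_), fun v s hsM hs => ?_⟩
      · refine iff_of_eq (congrArg P₁ (funext fun k => ?_))
        cases k <;> rfl
      · have key : ∀ a : (SetStr.mk ℓ M.A).Dom,
            SatIn M.A ℓ e₁ (insert (ZFSet.pair n a.1) s) ↔ P₁ (scons a v) := fun a => by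
          refine h₁ _ _ (hM.insert (hM.pair (hM.of_code3 he).1
            (hM.trans.mem_trans a.2 hℓ)) hsM) ?_
          convert hs.insert n a.1 using 1
          funext k
          refine Fin.cases ?_ (fun k => ?_) k <;> rfl
        constructor
        · rintro ⟨n', e', h, h'⟩ a
          obtain ⟨-, rfl, rfl⟩ := code3_inj.1 h
          exact (key a).1 (h' a.1 a.2)
        · exact fun h => ⟨n, e₁, rfl, fun a ha => (key ⟨a, ha⟩).2 (h ⟨a, ha⟩)⟩
    · exact ⟨_, .const False, fun v s _ _ => iff_false_intro fun ⟨t, u, h', _⟩ => h ⟨t, u, h'⟩⟩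
  obtain ⟨P₀, hP₀, h₀⟩ := h₀
  obtain ⟨P₁, hP₁, h₁⟩ := h₁
  obtain ⟨P₂, hP₂, h₂⟩ := h₂
  obtain ⟨P₃, hP₃, h₃⟩ := h₃
  obtain ⟨P₄, hP₄, h₄⟩ := h₄
  refine ⟨_, PDef.or hP₀ (PDef.or hP₁ (PDef.or hP₂ (PDef.or hP₃ hP₄))), fun v s hsM hs => ?_⟩
  rw [ax ℓ hℓ e he s hsM, SatClause, h₀ v s hs, h₁ v s hs, h₂ v s hs, h₃ v s hsM hs,
    h₄ v s hsM hs]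

/-! #### Every definable set has a code -/

/-- `s` is the assignment that maps the variable `0` to `z` and the variable `k + 1` to `v k`. -/
def AssignsSnoc {n : ℕ} (s z : ZFSet.{u}) (v : Fin n → ZFSet.{u}) : Prop :=
  ∀ t a, ZFSet.pair t a ∈ s ↔
    (t = varName 0 ∧ a = z) ∨ ∃ k : Fin n, t = varName (k + 1) ∧ a = v k

omit ax in
lemma exists_term_code {n : ℕ}
    (t : lang.Term (((Set.univ : Set (SetStr.mk ℓ M.A).Dom) ⊕ Fin 1) ⊕ Fin n)) :
    ∃ c ∈ M.X, ∀ (z : (SetStr.mk ℓ M.A).Dom) (v : Fin n → (SetStr.mk ℓ M.A).Dom) (s : ZFSet.{u}),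
      AssignsSnoc s z.1 (fun k => (v k).1) → ∀ a, Val s c a ↔
        a = (t.realize (Sum.elim (Sum.elim (fun x => x.1) fun _ => z) v)).1 := by
  rcases t with ((c | i) | k) | ⟨f, -⟩
  · refine ⟨tag 0 c.1.1, hM.tag 0 (hM.trans.mem_trans c.1.2 hℓ), fun z v s hs a => ?_⟩
    simp [Val, hs _ _, varName, eq_comm]
  · refine ⟨varName 0, hM.tag 1 (hM.num 0), fun z v s hs a => ?_⟩
    simp [Val, hs _ _, varName, num_injective.eq_iff]
  · refine ⟨varName (k + 1), hM.tag 1 (hM.num _), fun z v s hs a => ?_⟩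
    simp only [Val, hs _ _, varName, tag_inj, num_injective.eq_iff, true_and, Term.realize_var,
      Sum.elim_inr]
    constructor
    · rintro ((h | ⟨k', h, rfl⟩) | h)
      · omega
      · rw [show k = k' from Fin.ext (by omega)]
      · omega
    · rintro rfl
      exact Or.inl (Or.inr ⟨k, rfl, rfl⟩)
  · exact f.elim

/-- Variable 0 is reserved for the element being tested, and the quantifier at depth `n` binds
variable `n + 1`. This name is always fresh, so extending the assignment by `insert` corresponds to
`Fin.snoc`. -/
lemma exists_code {n : ℕ}
    (φ : lang.BoundedFormula ((Set.univ : Set (SetStr.mk ℓ M.A).Dom) ⊕ Fin 1) n) :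
    ∃ e ∈ M.X, ∀ (z : (SetStr.mk ℓ M.A).Dom) (v : Fin n → (SetStr.mk ℓ M.A).Dom), ∀ s ∈ M.X,
      AssignsSnoc s z.1 (fun k => (v k).1) →
        (φ.Realize (Sum.elim (fun x => x.1) fun _ => z) v ↔ SatIn M.A ℓ e s) := by
  induction φ with
  | falsum =>
    -- The empty set is not a pair, so no clause of `SatClause` applies to it and it codes falsity.
    refine ⟨∅, hM.empty, fun z v s hs _ => ?_⟩
    rw [ax ℓ hℓ _ hM.empty s hs]
    have h : ∀ x y : ZFSet.{u}, ∅ ≠ ZFSet.pair x y := fun x y h =>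
      (ZFSet.eq_empty _).1 h.symm {x} (by simp [ZFSet.pair])
    simp [SatClause, code3, tag, h, BoundedFormula.Realize]
  | equal t u =>
    obtain ⟨c, hc, ht⟩ := exists_term_code hM hℓ t
    obtain ⟨d, hd, hu⟩ := exists_term_code hM hℓ u
    have he := hM.code3 1 hc hd
    refine ⟨_, he, fun z v s hsM hs => ?_⟩
    rw [ax ℓ hℓ _ he s hsM]
    simp only [SatClause, code3_inj, OfNat.one_ne_ofNat, OfNat.ofNat_ne_one, one_ne_zero,
      false_and, exists_false, or_false, false_or, (tag_ne_code3 _).symm, ne_eq,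
      not_false_eq_true, true_and, BoundedFormula.Realize]
    constructor
    · intro h
      exact ⟨c, d, ⟨rfl, rfl⟩, _, Subtype.prop _, _, Subtype.prop _, (ht z v s hs _).2 rfl,
        (hu z v s hs _).2 rfl, congrArg Subtype.val h⟩
    · rintro ⟨_, _, ⟨rfl, rfl⟩, a, ha, b, hb, h1, h2, h3⟩
      rw [ht z v s hs] at h1
      rw [hu z v s hs] at h2
      exact Subtype.ext (h1.symm.trans (h3.trans h2))
  | rel R ts =>
    cases R with
    | mem =>
      obtain ⟨c, hc, ht⟩ := exists_term_code hM hℓ (ts 0)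
      obtain ⟨d, hd, hu⟩ := exists_term_code hM hℓ (ts 1)
      have he := hM.code3 0 hc hd
      refine ⟨_, he, fun z v s hsM hs => ?_⟩
      rw [ax ℓ hℓ _ he s hsM]
      simp only [SatClause, code3_inj, OfNat.zero_ne_ofNat, zero_ne_one, false_and, exists_false,
        or_false, (tag_ne_code3 _).symm, ne_eq, OfNat.ofNat_ne_zero, not_false_eq_true, true_and]
      constructor
      · intro h
        exact ⟨c, d, ⟨rfl, rfl⟩, _, Subtype.prop _, _, Subtype.prop _, (ht z v s hs _).2 rfl,
          (hu z v s hs _).2 rfl, h⟩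
      · rintro ⟨_, _, ⟨rfl, rfl⟩, a, ha, b, hb, h1, h2, h3⟩
        rw [ht z v s hs] at h1
        rw [hu z v s hs] at h2
        rw [h1, h2] at h3
        exact h3
    | pred =>
      obtain ⟨c, hc, ht⟩ := exists_term_code hM hℓ (ts 0)
      have he := hM.tag 2 hc
      refine ⟨_, he, fun z v s hsM hs => ?_⟩
      rw [ax ℓ hℓ _ he s hsM]
      simp only [SatClause, tag_ne_code3, ne_eq, OfNat.ofNat_ne_zero, OfNat.ofNat_ne_one,
        not_false_eq_true, false_and, exists_false, false_or, tag_inj, true_and,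
        Nat.reduceEqDiff, or_false]
      constructor
      · intro h
        exact ⟨c, rfl, _, Subtype.prop _, (ht z v s hs _).2 rfl, h⟩
      · rintro ⟨_, rfl, a, ha, h1, h2⟩
        rw [ht z v s hs] at h1
        rw [h1] at h2
        exact h2
  | imp φ ψ ihφ ihψ =>
    obtain ⟨c, hc, hφ⟩ := ihφ
    obtain ⟨d, hd, hψ⟩ := ihψ
    have he := hM.code3 3 hc hd
    refine ⟨_, he, fun z v s hsM hs => ?_⟩
    rw [ax ℓ hℓ _ he s hsM, BoundedFormula.realize_imp, hφ z v s hsM hs, hψ z v s hsM hs]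
    simp [SatClause, (tag_ne_code3 _).symm]
  | @all n φ ih =>
    obtain ⟨c, hc, hφ⟩ := ih
    have hn : varName (n + 1) ∈ M.X := hM.tag 1 (hM.num _)
    have he := hM.code3 4 hn hc
    refine ⟨_, he, fun z v s hsM hs => ?_⟩
    have key : ∀ a : (SetStr.mk ℓ M.A).Dom,
        (φ.Realize (Sum.elim (fun x => x.1) fun _ => z) (Fin.snoc v a) ↔
          SatIn M.A ℓ c (insert (ZFSet.pair (varName (n + 1)) a.1) s)) := fun a => by
      refine hφ z _ _ (hM.insert (hM.pair hn (hM.trans.mem_trans a.2 hℓ)) hsM) fun t b => ?_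
      rw [ZFSet.mem_insert_iff, ZFSet.pair_inj, hs]
      constructor
      · rintro (⟨rfl, rfl⟩ | h | ⟨k, h1, h2⟩)
        · exact Or.inr ⟨Fin.last n, by simp⟩
        · exact Or.inl h
        · exact Or.inr ⟨k.castSucc, by simpa using ⟨h1, h2⟩⟩
      · rintro (h | ⟨k, h1, h2⟩)
        · exact Or.inr (Or.inl h)
        · induction k using Fin.lastCases with
          | last =>
            simp only [Fin.val_last, Fin.snoc_last] at h1 h2
            exact Or.inl ⟨h1, h2⟩
          | cast k =>
            simp only [Fin.val_castSucc, Fin.snoc_castSucc] at h1 h2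
            exact Or.inr (Or.inr ⟨k, h1, h2⟩)
    rw [ax ℓ hℓ _ he s hsM, BoundedFormula.realize_all, forall_congr' key]
    simp only [SatClause, (tag_ne_code3 _).symm, code3_inj, OfNat.ofNat_ne_zero,
      OfNat.ofNat_ne_one, Nat.reduceEqDiff, ne_eq, not_false_eq_true, false_and, exists_false,
      false_or, true_and]
    constructor
    · exact fun h => ⟨_, _, ⟨rfl, rfl⟩, fun a ha => h ⟨a, ha⟩⟩
    · rintro ⟨_, _, ⟨rfl, rfl⟩, h⟩ a
      exact h a.1 a.2

/-- The definable subsets of `ℓ ∈ M` are the sets `subOf A ℓ e`, for `e ∈ M`. -/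
theorem mem_DefPow_iff {y : ZFSet.{u}} :
    y ∈ DefPow M.A ℓ ↔ ∃ e ∈ M.X, y = subOf M.A ℓ e := by
  constructor
  · intro hy
    rw [DefPow, ZFSet.mem_sep, ZFSet.mem_powerset] at hy
    obtain ⟨φ, hφ⟩ := Set.definable_iff_exists_formula_sum.1 hy.2
    obtain ⟨e, he, h⟩ := exists_code hM ax hℓ φ
    refine ⟨e, he, ZFSet.ext fun z => ?_⟩
    rw [subOf, ZFSet.mem_sep]
    refine ⟨fun hz => ⟨hy.1 hz, ?_⟩, fun ⟨hz, h'⟩ => ?_⟩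
    all_goals
      have hzℓ : z ∈ ℓ := by first | exact hz | exact hy.1 hz
      have hasg : asg z ∈ M.X := hM.insert (hM.pair (hM.tag 1 (hM.num 0))
        (hM.trans.mem_trans hzℓ hℓ)) hM.empty
      have h1 := h ⟨z, hzℓ⟩ default (asg z) hasg fun t a => by simp [asg]
      have h2 : z ∈ y ↔ _ := Set.ext_iff.1 hφ fun _ => ⟨z, hzℓ⟩
    · exact h1.1 (h2.1 hz)
    · exact h2.2 (h1.2 h')
  · rintro ⟨e, he, rfl⟩
    refine mem_DefPow.2 ⟨ZFSet.sep_subset, ?_⟩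
    obtain ⟨P, hP, h⟩ := pdef_satIn hM ax hℓ he fun _ : Fin 1 => varName 0
    refine hP.congr fun _ v => ?_
    have hasg : asg (v 0).1 ∈ M.X := hM.insert (hM.pair (hM.tag 1 (hM.num 0))
      (hM.trans.mem_trans (v 0).2 hℓ)) hM.empty
    rw [subOf, ZFSet.mem_sep, and_iff_right (v 0).2]
    refine h v _ hasg ?_
    convert assigns_asg (v 0).1 using 2 with k
    rw [Subsingleton.elim k 0]
    rfl

end TransSpectra

namespace TransSpectra

open FirstOrder FirstOrder.Language

/-! ### Transitive models of the axioms -/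

lemma SetStr.Transitive.exists_hasHeight {M : SetStr.{u}} (hM : M.Transitive) :
    ∃ α, M.HasHeight α := by
  refine ⟨sInf {o | o.toZFSet ∉ M.X}, fun o => ⟨fun h => ?_, fun h => ?_⟩⟩
  · have hne : {o : Ordinal.{u} | o.toZFSet ∉ M.X}.Nonempty :=
      ⟨M.X.rank, fun h => by simpa using ZFSet.rank_lt_of_mem h⟩
    by_contra! hle
    refine csInf_mem hne ?_
    rcases hle.eq_or_lt with h' | h'
    · exact h' ▸ h
    · exact hM.mem_trans (Ordinal.toZFSet_mem_toZFSet_iff.2 h') h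
  · by_contra h'
    exact notMem_of_lt_csInf' h h'

lemma InsertClosed.isSuccLimit {M : SetStr.{u}} (hM : InsertClosed M) {α : Ordinal.{u}}
    (hα : M.HasHeight α) : Order.IsSuccLimit α := by
  refine ⟨fun h => ?_, ?_⟩
  · have h0 : α = 0 := h.eq_bot
    exact absurd ((hα 0).1 (by simpa using hM.empty)) (by simp [h0])
  · refine Order.isSuccPrelimit_of_succ_lt fun β hβ => ?_
    rw [Order.succ_eq_add_one, ← hα, Ordinal.toZFSet_add_one]
    exact hM.insert ((hα β).2 hβ) ((hα β).2 hβ)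

lemma hasHeight_LStr (A : Set ZFSet.{u}) (α : Ordinal.{u}) : (LStr A α).HasHeight α :=
  fun _ => toZFSet_mem_LL

namespace LAxioms

variable {M : SetStr.{u}} (hM : InsertClosed M) (ax : LAxioms M)
include hM ax

/-- By induction, the sets representing earlier levels are the true ones, and `mem_DefPow_iff` makes
their coded subsets the true definable subsets. The axiom `lev` then makes the new level an element
of `M`, and `sub` ensures that no element of the true level is missing from `M`. -/
lemma lev_spec (β : Ordinal.{u}) (hβ : β.toZFSet ∈ M.X) :
    (∀ z ∈ M.X, LevIn M.A β.toZFSet z ↔ z ∈ LL M.A β) ∧ LL M.A β ∈ M.X := by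
  induction β using WellFoundedLT.induction with
  | ind β ih =>
    have ih' : ∀ γ < β, (∀ z ∈ M.X, LevIn M.A γ.toZFSet z ↔ z ∈ LL M.A γ) ∧ LL M.A γ ∈ M.X :=
      fun γ hγ => ih γ hγ (hM.trans.mem_trans (Ordinal.toZFSet_mem_toZFSet_iff.2 hγ) hβ)
    have h1 : ∀ z ∈ M.X, LevIn M.A β.toZFSet z ↔ z ∈ LL M.A β := by
      intro z hz
      rw [ax.lev_iff _ hβ (ZFSet.isOrdinal_toZFSet β) z hz, mem_LL]
      constructor
      · rintro ⟨c, hc, ℓ, hℓ, hℓc, he⟩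
        obtain ⟨γ, hγ, rfl⟩ := Ordinal.mem_toZFSet_iff.1 hc
        obtain ⟨h1, h2⟩ := ih' γ hγ
        have : ℓ = LL M.A γ := by
          ext x
          refine ⟨fun hx => ?_, fun hx => ?_⟩
          · have hxM := hM.trans.mem_trans hx hℓ
            exact (h1 x hxM).1 ((hℓc x hxM).1 hx)
          · have hxM := hM.trans.mem_trans hx h2
            exact (hℓc x hxM).2 ((h1 x hxM).2 hx)
        subst this
        exact ⟨γ, hγ, (mem_DefPow_iff hM ax.sat hℓ).2 he⟩
      · rintro ⟨γ, hγ, h⟩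
        obtain ⟨h1, h2⟩ := ih' γ hγ
        exact ⟨_, Ordinal.toZFSet_mem_toZFSet_iff.2 hγ, _, h2, fun x hx => (h1 x hx).symm,
          (mem_DefPow_iff hM ax.sat h2).1 h⟩
    refine ⟨h1, ?_⟩
    obtain ⟨ℓ, hℓ, h2⟩ := ax.lev _ hβ (ZFSet.isOrdinal_toZFSet β)
    have : ℓ = LL M.A β := by
      ext x
      refine ⟨fun hx => ?_, fun hx => ?_⟩
      · have hxM := hM.trans.mem_trans hx hℓ
        exact (h1 x hxM).1 ((h2 x hxM).1 hx)
      · obtain ⟨γ, hγ, hx'⟩ := mem_LL.1 hx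
        obtain ⟨e, he, rfl⟩ := (mem_DefPow_iff hM ax.sat (ih' γ hγ).2).1 hx'
        have hxM := ax.sub _ (ih' γ hγ).2 e he
        exact (h2 _ hxM).2 ((h1 _ hxM).2 hx)
    exact this ▸ hℓ

/-- The transitive models of the axioms are of the form `L_α[A]`. -/
theorem eq_LL {α : Ordinal.{u}} (hα : M.HasHeight α) : M.X = LL M.A α := by
  have hlim := hM.isSuccLimit hα
  ext x
  constructor
  · intro hx
    obtain ⟨b, hb, hord, hbx⟩ := ax.exists_lev x hx
    obtain ⟨β, rfl⟩ := ZFSet.isOrdinal_iff_mem_range_toZFSet.1 hord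
    exact LL_mono ((hα β).1 hb).le (((lev_spec hM ax β hb).1 x hx).1 hbx)
  · intro hx
    obtain ⟨β, hβ, hx⟩ := exists_mem_LL_of_isSuccLimit hlim hx
    exact hM.trans.mem_trans hx (lev_spec hM ax β ((hα β).2 hβ)).2

end LAxioms

end TransSpectra

namespace TransSpectra

open FirstOrder FirstOrder.Language

/-! ### Construction of models -/

/-- The clauses consult `A` only on `ℓ` and `R` only at codes of smaller rank. This locality permits
both the recursion defining satisfaction and the one defining `A`. -/
lemma SatClause.congr {A A' : Set ZFSet.{u}} {R R' : ZFSet.{u} → ZFSet.{u} → Prop}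
    {ℓ e s : ZFSet.{u}} (hA : ∀ a ∈ ℓ, a ∈ A ↔ a ∈ A')
    (hR : ∀ e', e'.rank < e.rank → ∀ s, R e' s ↔ R' e' s) :
    SatClause A R ℓ e s ↔ SatClause A' R' ℓ e s := by
  unfold SatClause
  refine or_congr Iff.rfl (or_congr Iff.rfl (or_congr ?_ (or_congr ?_ ?_)))
  · exact exists_congr fun t => and_congr_right fun _ => exists_congr fun a =>
      and_congr_right fun ha => and_congr_right fun _ => hA a ha
  · refine exists_congr fun e₁ => exists_congr fun e₂ => and_congr_right fun he => ?_
    rw [hR e₁ (he ▸ rank_lt_code3_left _ _ _), hR e₂ (he ▸ rank_lt_code3_right _ _ _)]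
  · refine exists_congr fun n => exists_congr fun e₁ => and_congr_right fun he => ?_
    exact forall₂_congr fun a _ => hR e₁ (he ▸ rank_lt_code3_right _ _ _) _

/-- Recursion on the rank. -/
lemma exists_rank_fix {α : Type*} (F : (ZFSet.{u} → α → Prop) → ZFSet.{u} → α → Prop) :
    ∃ R : ZFSet.{u} → α → Prop, ∀ x a, R x a ↔ F (fun y b => y.rank < x.rank ∧ R y b) x a := by
  have wf : WellFounded fun x y : ZFSet.{u} => x.rank < y.rank := InvImage.wf _ wellFounded_lt
  let G : ∀ x : ZFSet.{u}, (∀ y : ZFSet.{u}, y.rank < x.rank → α → Prop) → α → Prop :=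
    fun x ih a => F (fun y b => ∃ h : y.rank < x.rank, ih y h b) x a
  refine ⟨wf.fix G, fun x a => ?_⟩
  rw [wf.fix_eq]
  simp only [G, exists_prop]

lemma exists_satOf (A : Set ZFSet.{u}) (ℓ : ZFSet.{u}) :
    ∃ R : ZFSet.{u} → ZFSet.{u} → Prop, ∀ e s, R e s ↔ SatClause A R ℓ e s := by
  obtain ⟨R, hR⟩ := exists_rank_fix fun R e s => SatClause A R ℓ e s
  exact ⟨R, fun e s => (hR e s).trans (SatClause.congr (fun _ _ => Iff.rfl)
    fun e' he s => and_iff_right he)⟩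

/-- The satisfaction relation of `(ℓ, ∈, A)`. -/
def satOf (A : Set ZFSet.{u}) (ℓ : ZFSet.{u}) : ZFSet.{u} → ZFSet.{u} → Prop :=
  (exists_satOf A ℓ).choose

lemma satOf_iff (A : Set ZFSet.{u}) (ℓ e s : ZFSet.{u}) :
    satOf A ℓ e s ↔ SatClause A (satOf A ℓ) ℓ e s :=
  (exists_satOf A ℓ).choose_spec e s

lemma satOf_congr {A A' : Set ZFSet.{u}} {ℓ : ZFSet.{u}} (hA : ∀ a ∈ ℓ, a ∈ A ↔ a ∈ A')
    (e s : ZFSet.{u}) : satOf A ℓ e s ↔ satOf A' ℓ e s := by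
  induction h : e.rank using WellFoundedLT.induction generalizing e s with
  | ind o ih =>
    subst h
    rw [satOf_iff, satOf_iff]
    exact SatClause.congr hA fun e' he s => ih _ he _ _ rfl

/-- The first component of `tup k x y` is a Kuratowski pair: it is non-empty and `∅` is not an
element of it. A non-zero ordinal contains `∅`, so the two kinds of code cannot clash. -/
lemma tup_ne_pair_toZFSet (k : ℕ) (x y z : ZFSet.{u}) (ξ : Ordinal.{u}) :
    tup k x y ≠ ZFSet.pair ξ.toZFSet z := by
  intro h
  have h1 : ZFSet.pair (num k) x = ξ.toZFSet := (ZFSet.pair_inj.1 h).1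
  have h2 : ∀ w ∈ ZFSet.pair (num k) x, w ≠ (∅ : ZFSet.{u}) := by
    rintro w hw rfl
    rcases ZFSet.mem_pair.1 hw with h | h
    · exact (ZFSet.eq_empty _).1 h.symm (num k) (by simp)
    · exact (ZFSet.eq_empty _).1 h.symm (num k) (by simp)
  rcases eq_or_ne ξ 0 with rfl | h0
  · rw [Ordinal.toZFSet_zero] at h1
    exact (ZFSet.eq_empty _).1 h1 {num k} (by simp [ZFSet.pair])
  · refine h2 ∅ ?_ rfl
    rw [h1, ← Ordinal.toZFSet_zero]
    exact Ordinal.toZFSet_mem_toZFSet_iff.2 (pos_iff_ne_zero.2 h0)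

/-- There is a predicate that codes a given relation on the ordinals, its own satisfaction relations
and constructible hierarchy, and given partial functions. -/
lemma exists_predicate (E : Ordinal.{u} → Ordinal.{u} → Prop)
    (G : ZFSet.{u} → ZFSet.{u} → ZFSet.{u} → ZFSet.{u} → Prop) : ∃ A : Set ZFSet.{u},
    (∀ ξ i : Ordinal.{u}, ZFSet.pair ξ.toZFSet i.toZFSet ∈ A ↔ E ξ i) ∧
    (∀ ℓ e s, SatIn A ℓ e s ↔ satOf A ℓ e s) ∧
    (∀ (β : Ordinal.{u}) x, LevIn A β.toZFSet x ↔ x ∈ LL A β) ∧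
    ∀ δ a b c, PairIn A δ a b c ↔ G δ a b c := by
  -- Here `B` is the part of the predicate below the rank of `t`. It suffices: elements of `ℓ`,
  -- respectively of `L_β[A]`, have rank below that of `ℓ`, respectively `β`, and hence below that
  -- of the tuple.
  obtain ⟨R, hR⟩ := exists_rank_fix fun (B : ZFSet.{u} → Unit → Prop) t (_ : Unit) =>
    (∃ ξ i : Ordinal.{u}, t = ZFSet.pair ξ.toZFSet i.toZFSet ∧ E ξ i) ∨
    (∃ ℓ e s, t = tup 0 ℓ (ZFSet.pair e s) ∧ satOf {y | B y ()} ℓ e s) ∨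
    (∃ (β : Ordinal.{u}) (x : ZFSet.{u}), t = tup 1 β.toZFSet x ∧ x ∈ LL {y | B y ()} β) ∨
    ∃ δ a b c, t = tup 2 δ (ZFSet.pair (ZFSet.pair a b) c) ∧ G δ a b c
  refine ⟨{y | R y ()}, fun ξ i => ?_, fun ℓ e s => ?_, fun β x => ?_, fun δ a b c => ?_⟩
  · refine (hR _ _).trans ?_
    simp [(tup_ne_pair_toZFSet _ _ _ _ _).symm, Ordinal.toZFSet_injective.eq_iff]
  · refine (hR _ _).trans ?_
    simp only [tup_ne_pair_toZFSet, tup_inj, ZFSet.pair_inj, false_and, exists_false, false_or,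
      true_and, zero_ne_one, OfNat.zero_ne_ofNat, or_false]
    have key : ∀ e s, satOf {y | y.rank < (tup 0 ℓ (ZFSet.pair e s)).rank ∧ R y ()} ℓ e s ↔
        satOf {y | R y ()} ℓ e s := fun e s => by
      refine satOf_congr (fun a ha => ?_) e s
      exact and_iff_right ((ZFSet.rank_lt_of_mem ha).trans (rank_lt_tup_left _ _ _))
    constructor
    · rintro ⟨_, _, _, ⟨rfl, rfl, rfl⟩, h⟩
      exact (key _ _).1 h
    · exact fun h => ⟨_, _, _, ⟨rfl, rfl, rfl⟩, (key _ _).2 h⟩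
  · refine (hR _ _).trans ?_
    simp only [tup_ne_pair_toZFSet, tup_inj, false_and, exists_false, false_or,
      true_and, one_ne_zero, OfNat.one_ne_ofNat, or_false]
    have key : LL {y | y.rank < (tup 1 β.toZFSet x).rank ∧ R y ()} β = LL {y | R y ()} β := by
      refine LL_congr fun z hz => and_iff_right ((rank_lt_of_mem_LL hz).trans ?_)
      simpa using rank_lt_tup_left 1 β.toZFSet x
    constructor
    · rintro ⟨γ, _, ⟨h, rfl⟩, h'⟩
      obtain rfl := Ordinal.toZFSet_injective h
      exact key ▸ h'
    · exact fun h => ⟨_, _, ⟨rfl, rfl⟩, key ▸ h⟩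
  · refine (hR _ _).trans ?_
    simp only [tup_ne_pair_toZFSet, tup_inj, ZFSet.pair_inj, false_and, exists_false, false_or,
      true_and, OfNat.ofNat_ne_zero, OfNat.ofNat_ne_one]
    constructor
    · rintro ⟨_, _, _, _, ⟨rfl, ⟨rfl, rfl⟩, rfl⟩, h⟩
      exact h
    · exact fun h => ⟨_, _, _, _, ⟨rfl, ⟨rfl, rfl⟩, rfl⟩, h⟩

/-- A set containing `∅` and closed under successor contains all finite ordinals, so it is infinite
and equinumerous with its square. -/
lemma exists_pairing : ∃ G : ZFSet.{u} → ZFSet.{u} → ZFSet.{u} → ZFSet.{u} → Prop,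
    ∀ δ, ∅ ∈ δ → (∀ a ∈ δ, insert a a ∈ δ) →
    (∀ a ∈ δ, ∀ b ∈ δ, ∃ c ∈ δ, G δ a b c) ∧
    ∀ a ∈ δ, ∀ b ∈ δ, ∀ a' ∈ δ, ∀ b' ∈ δ, ∀ c ∈ δ,
      G δ a b c → G δ a' b' c → a = a' ∧ b = b' := by
  have key : ∀ δ : ZFSet.{u}, ∃ G : ZFSet.{u} → ZFSet.{u} → ZFSet.{u} → Prop,
      ∅ ∈ δ → (∀ a ∈ δ, insert a a ∈ δ) → (∀ a ∈ δ, ∀ b ∈ δ, ∃ c ∈ δ, G a b c) ∧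
      ∀ a ∈ δ, ∀ b ∈ δ, ∀ a' ∈ δ, ∀ b' ∈ δ, ∀ c ∈ δ,
        G a b c → G a' b' c → a = a' ∧ b = b' := by
    intro δ
    by_cases h : ∅ ∈ δ ∧ ∀ a ∈ δ, insert a a ∈ δ
    · have hn : ∀ n : ℕ, (n : Ordinal.{u}).toZFSet ∈ δ := fun n => by
        induction n with
        | zero => simpa using h.1
        | succ n ih => simpa using h.2 _ ih
      have : Infinite {x // x ∈ δ} := Infinite.of_injective (fun n : ℕ => ⟨_, hn n⟩) fun m n h => by
        simpa using Ordinal.toZFSet_injective (congrArg Subtype.val h)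
      have hc : #({x // x ∈ δ} × {x // x ∈ δ}) = #{x // x ∈ δ} := by
        rw [← mul_def, mul_eq_self (aleph0_le_mk _)]
      obtain ⟨f⟩ := Cardinal.eq.1 hc
      refine ⟨fun a b c => ∃ ha hb, (f (⟨a, ha⟩, ⟨b, hb⟩)).1 = c, fun _ _ => ⟨fun a ha b hb =>
        ⟨_, (f (⟨a, ha⟩, ⟨b, hb⟩)).2, ha, hb, rfl⟩, ?_⟩⟩
      rintro a - b - a' - b' - c - ⟨ha, hb, rfl⟩ ⟨ha', hb', h⟩
      have := f.injective (Subtype.ext h)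
      simp only [Prod.mk.injEq, Subtype.mk.injEq] at this
      exact ⟨this.1.symm, this.2.symm⟩
    · exact ⟨fun _ _ _ => True, fun h1 h2 => (h ⟨h1, h2⟩).elim⟩
  choose G hG using key
  exact ⟨G, hG⟩

/-- Satisfaction for `ℓ` is read off from `A`, so the set is definable over `L_γ[A]` from `ℓ` and
`e`. At limit `γ` the level contains the tuples that the definition uses. -/
lemma subOf_mem_LL {A : Set ZFSet.{u}} {γ : Ordinal.{u}} (hγ : Order.IsSuccLimit γ)
    {ℓ e : ZFSet.{u}} (hℓ : ℓ ∈ LL A γ) (he : e ∈ LL A γ) : subOf A ℓ e ∈ LL A (γ + 1) := by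
  have h : FO InsertClosed.{u} fun M v => (v 0).1 ∈ (v 1).1 ∧
      SatIn M.1.A (v 1).1 (v 2).1 (asg (v 0).1) :=
    .and (.mem 0 1) (.satIn (fun _ h => h) (.var 1) (.var 2) (.asg (fun _ h => h) (.var 0)))
  refine mem_LL.2 ⟨γ, Order.lt_add_one_iff.2 le_rfl, mem_DefPow_of_FO h (insertClosed_LStr hγ)
    (scons ⟨ℓ, hℓ⟩ fun _ => ⟨e, he⟩) ?_ fun z => ZFSet.mem_sep⟩
  exact ZFSet.sep_subset.trans (LL_transitive A γ _ hℓ)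

/-- For every infinite `ρ` there is a model of the axioms of the form `L_α[A]` such that `A` codes
an enumeration of `𝒫(ρ)`. -/
theorem exists_model {ρ : Cardinal.{u}} (hρ : ℵ₀ ≤ ρ) : ∃ (α : Ordinal.{u}) (A : Set ZFSet.{u}),
    Order.IsSuccLimit α ∧ CodesPowerset A ρ α ∧ LAxioms (LStr A α) := by
  have hlt : ℵ₀ < (2 : Cardinal.{u}) ^ ρ := hρ.trans_lt (cantor ρ)
  -- An initial ordinal of the right cardinality for the enumeration; being uncountable, it is
  -- closed under `β ↦ β + ω`, which the axiom `sub` needs.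
  set α : Ordinal.{u} := ((2 : Cardinal.{u}) ^ ρ).ord with hα
  have hlim : Order.IsSuccLimit α := isSuccLimit_ord hlt.le
  have hω : ∀ β < α, β + Ordinal.omega0 < α := fun β hβ =>
    Ordinal.isPrincipal_add_ord hlt.le hβ (by rw [lt_ord, Ordinal.card_omega0]; exact hlt)
  have hcard : #(Set.Iio α) = #(Set (Set.Iio ρ.ord)) := by
    rw [mk_set, mk_Iio_ordinal, mk_Iio_ordinal, hα, card_ord, card_ord, lift_two_power]
  obtain ⟨f⟩ := Cardinal.eq.1 hcard
  obtain ⟨G, hG⟩ := exists_pairing.{u}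
  obtain ⟨A, hE, hsat, hlev, hpair⟩ := exists_predicate
    (fun ξ i => ∃ (hξ : ξ < α) (hi : i < ρ.ord), ⟨i, hi⟩ ∈ f ⟨ξ, hξ⟩) G
  have hIC := insertClosed_LStr (A := A) hlim
  have hS : ∀ ℓ e s, SatIn A ℓ e s ↔ SatClause A (SatIn A ℓ) ℓ e s := fun ℓ e s => by
    rw [hsat, satOf_iff]
    exact SatClause.congr (fun _ _ => Iff.rfl) fun e' _ s => (hsat _ _ _).symm
  refine ⟨α, A, hlim, ?_, ?_⟩
  · refine ⟨fun ξ _ i hi => hi.1, fun ξ hξ η hη h => ?_, fun Y hY => ?_⟩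
    · have : f ⟨ξ, hξ⟩ = f ⟨η, hη⟩ := Set.ext fun i => by
        have := Set.ext_iff.1 h i.1
        simp only [hE, Set.mem_ofPred_eq] at this
        have hi : i.1 < ρ.ord := i.2
        simpa [hi, show ξ < α from hξ, show η < α from hη] using this
      simpa using f.injective this
    · refine ⟨(f.symm {i | i.1 ∈ Y}).1, (f.symm {i | i.1 ∈ Y}).2, Set.ext fun i => ?_⟩
      have h1 : (f.symm {i | i.1 ∈ Y}).1 < α := (f.symm {i | i.1 ∈ Y}).2
      have hf : ∀ i : Set.Iio ρ.ord, i ∈ f ⟨(f.symm {i | i.1 ∈ Y}).1, h1⟩ ↔ i.1 ∈ Y := fun i => by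
        have h2 : f (f.symm {i | i.1 ∈ Y}) = {i | i.1 ∈ Y} := f.apply_symm_apply _
        exact Set.ext_iff.1 h2 i
      simp only [hE, Set.mem_ofPred_eq]
      exact ⟨fun h => (hf _).1 h.2.2.2, fun h => ⟨hY h, h1, hY h, (hf ⟨i, hY h⟩).2 h⟩⟩
  · refine ⟨fun ℓ _ e _ s _ => hS ℓ e s, fun ℓ hℓ e he => ?_, fun b hb hord => ?_,
      fun b hb hord x hx => ?_, fun x hx => ?_, fun δ _ h0 hsucc => ?_⟩
    · obtain ⟨β, hβ, hℓ⟩ := exists_mem_LL_of_isSuccLimit hlim hℓ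
      obtain ⟨γ, hγ, he⟩ := exists_mem_LL_of_isSuccLimit hlim he
      -- A limit stage containing `ℓ` and `e` whose successor is still at most `α`.
      have h1 : max β γ ≤ max β γ + Ordinal.omega0 := le_self_add
      have hl : Order.IsSuccLimit (max β γ + Ordinal.omega0) :=
        Ordinal.isSuccLimit_add _ Ordinal.isSuccLimit_omega0
      exact LL_mono (Order.add_one_le_of_lt (hω _ (max_lt hβ hγ))) (subOf_mem_LL hl
        (LL_mono ((le_max_left _ _).trans h1) hℓ) (LL_mono ((le_max_right _ _).trans h1) he))
    · obtain ⟨β, rfl⟩ := ZFSet.isOrdinal_iff_mem_range_toZFSet.1 hord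
      exact ⟨LL A β, LL_mem_LL (toZFSet_mem_LL.1 hb), fun z _ => (hlev β z).symm⟩
    · obtain ⟨β, rfl⟩ := ZFSet.isOrdinal_iff_mem_range_toZFSet.1 hord
      refine (hlev β x).trans (mem_LL.trans ⟨?_, ?_⟩)
      · rintro ⟨γ, hγ, h⟩
        have hm : LL A γ ∈ LL A α := LL_mem_LL (hγ.trans (toZFSet_mem_LL.1 hb))
        exact ⟨_, Ordinal.toZFSet_mem_toZFSet_iff.2 hγ, _, hm, fun z _ => (hlev γ z).symm,
          (mem_DefPow_iff hIC (fun ℓ _ e _ s _ => hS ℓ e s) hm).1 h⟩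
      · rintro ⟨c, hc, ℓ, hℓ, hℓc, he⟩
        obtain ⟨γ, hγ, rfl⟩ := Ordinal.mem_toZFSet_iff.1 hc
        have hm : LL A γ ∈ LL A α := LL_mem_LL (hγ.trans (toZFSet_mem_LL.1 hb))
        have : ℓ = LL A γ := by
          ext z
          by_cases hz : z ∈ LL A α
          · exact (hℓc z hz).trans (hlev γ z)
          · exact iff_of_false (fun h => hz (hIC.trans.mem_trans h hℓ))
              fun h => hz (hIC.trans.mem_trans h hm)
        subst this
        exact ⟨γ, hγ, (mem_DefPow_iff hIC (fun ℓ _ e _ s _ => hS ℓ e s) hm).2 he⟩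
    · obtain ⟨β, hβ, hx⟩ := exists_mem_LL_of_isSuccLimit hlim hx
      exact ⟨_, toZFSet_mem_LL.2 hβ, ZFSet.isOrdinal_toZFSet β, (hlev β x).2 hx⟩
    · have := hG δ h0 hsucc
      simp only [← hpair] at this
      exact this

end TransSpectra

namespace TransSpectra

open FirstOrder FirstOrder.Language

/-! ### Critical points -/

section CriticalPoint

variable {M N : SetStr.{u}} (j : M.ElemEmb N)

lemma j_mem {x y : M.Dom} : (j x).1 ∈ (j y).1 ↔ x.1 ∈ y.1 :=
  UDef.elem (C := fun _ => True) (UDef.mem 0 1) trivial trivial j (scons x fun _ => y)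

lemma j_pred {x : M.Dom} : (j x).1 ∈ N.A ↔ x.1 ∈ M.A :=
  UDef.elem (C := fun _ => True) (UDef.pred 0) trivial trivial j (fun _ => x)

variable (hM : M.Transitive) (hN : N.Transitive)
include hM hN

lemma j_isOrdinal {x : M.Dom} : (j x).1.IsOrdinal ↔ x.1.IsOrdinal :=
  UDef.elem (C := SetStr.Transitive) (UDef.isOrdinal (fun _ h => h) (.var 0)) hM hN j (fun _ => x)

lemma j_insert {x y z : M.Dom} :
    (j x).1 = insert (j y).1 (j z).1 ↔ x.1 = insert y.1 z.1 :=
  UDef.elem (C := SetStr.Transitive) (UDef.eq_insert (fun _ h => h) 0 1 2) hM hN j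
    (scons x (scons y fun _ => z))

variable {j}

omit hM hN in
lemma exists_isCrit {o : Ordinal.{u}} (ho : o.toZFSet ∈ M.X) (h : (j ⟨_, ho⟩).1 ≠ o.toZFSet) :
    ∃ κ ≤ o, j.IsCrit κ := by
  let S : Set Ordinal.{u} := {κ | ∃ h : κ.toZFSet ∈ M.X, (j ⟨κ.toZFSet, h⟩).1 ≠ κ.toZFSet}
  have hS : S.Nonempty := ⟨o, ho, h⟩
  refine ⟨sInf S, csInf_le' ⟨ho, h⟩, csInf_mem hS, fun a ha haM => ?_⟩
  by_contra h'
  exact notMem_of_lt_csInf' ha ⟨haM, h'⟩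

/-- Ordinals below `κ` are fixed, so they belong to the ordinal `j(κ)`; thus `κ ≤ j(κ)`, and
equality is excluded. -/
lemma SetStr.ElemEmb.IsCrit.mem {κ : Ordinal.{u}} (hκ : j.IsCrit κ) :
    κ.toZFSet ∈ (j ⟨κ.toZFSet, hκ.1.1⟩).1 := by
  obtain ⟨⟨hκM, hne⟩, hlt⟩ := hκ
  obtain ⟨o, ho⟩ := ZFSet.isOrdinal_iff_mem_range_toZFSet.1
    ((j_isOrdinal j hM hN (x := ⟨_, hκM⟩)).2 (ZFSet.isOrdinal_toZFSet κ))
  rw [← ho, Ordinal.toZFSet_mem_toZFSet_iff]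
  refine lt_of_le_of_ne ?_ fun h => hne (by rw [← ho, h])
  refine le_of_forall_lt fun a ha => ?_
  have haκ := Ordinal.toZFSet_mem_toZFSet_iff.2 ha
  have haM := hM.mem_trans haκ hκM
  rw [← Ordinal.toZFSet_mem_toZFSet_iff, ho, ← hlt a ha haM]
  exact (j_mem j (x := ⟨_, haM⟩) (y := ⟨_, hκM⟩)).2 haκ

/-- If `κ ≤ ω`, every element of `κ` is `∅` or a successor, hence so is every element of `j(κ)`,
including `κ`. But `κ = ∅` gives `j(κ) = ∅`, and `κ = b + 1` with `b` fixed gives `j(κ) = κ`. -/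
lemma SetStr.ElemEmb.IsCrit.omega0_lt {κ : Ordinal.{u}} (hκ : j.IsCrit κ) :
    Ordinal.omega0 < κ := by
  have hmem := hκ.mem hM hN
  obtain ⟨⟨hκM, hne⟩, hlt⟩ := hκ
  by_contra! hle
  have hT : ∀ M : SetStr.{u}, M.Transitive → M.Transitive := fun _ h => h
  have h : FO SetStr.Transitive.{u} fun M v => ∀ a ∈ (v 0).1,
      (∀ z ∈ a, False) ∨ ∃ b ∈ a, a = insert b b :=
    .ball hT (.var 0) (.or (.ball hT (.var 0) (.const False))
      (.bex hT (.var 0) (.eq_insert hT 1 0 0)))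
  have h1 := (UDef.elem h hM hN j fun _ => ⟨_, hκM⟩).2 (by
    intro a ha
    obtain ⟨o, ho, rfl⟩ := Ordinal.mem_toZFSet_iff.1 ha
    obtain ⟨n, rfl⟩ := Ordinal.lt_omega0.1 (ho.trans_le hle)
    rcases n with _ | n
    · left; simp
    · right
      refine ⟨(n : Ordinal).toZFSet, ?_, ?_⟩
      · simp
      · simp)
  rcases h1 _ hmem with h1 | ⟨b, hb, h1⟩
  · have h2 : FO SetStr.Transitive.{u} fun M v => ∀ a ∈ (v 0).1, False :=
      .ball hT (.var 0) (.const False)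
    exact (UDef.elem h2 hM hN j fun _ => ⟨_, hκM⟩).2 h1 _ hmem
  · obtain ⟨o, ho, rfl⟩ := Ordinal.mem_toZFSet_iff.1 hb
    have hoM := hM.mem_trans hb hκM
    have := (j_insert j hM hN (x := ⟨_, hκM⟩) (y := ⟨_, hoM⟩) (z := ⟨_, hoM⟩)).2 h1
    rw [hlt o ho hoM, ← h1] at this
    exact hne this

/-- If the subsets of a critical point `κ` and the functions from `κ` to smaller ordinals are
uniformly definable from parameters, then `κ` is a measurable cardinal. -/
theorem isMeasurableCardinal_of_isCrit {κ : Ordinal.{u}} (hκ : j.IsCrit κ)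
    {C : SetStr.{u} → Prop} (hCM : C M) (hCN : C N)
    {Q : ∀ M : {M : SetStr.{u} // C M}, M.1.Dom → M.1.Dom → Prop}
    {R : ∀ M : {M : SetStr.{u} // C M}, M.1.Dom → M.1.Dom → M.1.Dom → M.1.Dom → Prop}
    (hQ : FO C fun M v => Q M (v 0) (v 1)) (hR : FO C fun M v => R M (v 0) (v 1) (v 2) (v 3))
    (hsub : ∀ Y : Set Ordinal.{u}, ∃ p, ∀ a < κ, ∀ h : a.toZFSet ∈ M.X,
      Q ⟨M, hCM⟩ ⟨_, h⟩ p ↔ a ∈ Y)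
    (hfun : ∀ γ < κ, ∀ f : Ordinal.{u} → Ordinal.{u}, (∀ a < κ, f a < γ) → ∃ p q, ∀ a < κ, ∀ b < γ,
      ∀ (ha : a.toZFSet ∈ M.X) (hb : b.toZFSet ∈ M.X),
        R ⟨M, hCM⟩ ⟨_, ha⟩ ⟨_, hb⟩ p q ↔ f a = b) :
    ∃ μ : Cardinal.{u}, μ.ord = κ ∧ IsMeasurableCardinal μ := by
  have hmem : ∀ h, κ.toZFSet ∈ (j ⟨κ.toZFSet, h⟩).1 := fun _ => hκ.mem hM hN
  have hω := hκ.omega0_lt hM hN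
  obtain ⟨⟨hκM, -⟩, hfix⟩ := hκ
  have hltM : ∀ a < κ, a.toZFSet ∈ M.X := fun a ha =>
    hM.mem_trans (Ordinal.toZFSet_mem_toZFSet_iff.2 ha) hκM
  let k : M.Dom := ⟨_, hκM⟩
  let k' : N.Dom := ⟨κ.toZFSet, hN.mem_trans (hmem hκM) (j k).2⟩
  have hk' : k'.1 ∈ (j k).1 := hmem hκM
  have hQ' : ∀ a b, FO C fun M v => Q M (v a) (v b) := fun a b =>
    hQ.comp fun i => if i = 0 then a else b
  have hR' : ∀ a b c d, FO C fun M v => R M (v a) (v b) (v c) (v d) := fun a b c d =>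
    hR.comp fun i => if i = 0 then a else if i = 1 then b else if i = 2 then c else d
  choose p hp using hsub
  -- The derived measure: `Y` is large when `κ ∈ j(Y)`, with `Y` represented by its code `p Y`.
  -- Facts about all elements of `κ` transfer to all elements of `j(κ)` and are evaluated at `κ`.
  let D : Set Ordinal.{u} → Prop := fun Y => Q ⟨N, hCN⟩ k' (j (p Y))
  have hinter : ∀ Y Z W : Set Ordinal.{u}, (∀ a < κ, a ∈ Y → a ∈ Z → a ∈ W) → D Y → D Z → D W := by
    intro Y Z W h hY hZ
    have hF : FO C fun M v => ∀ a : M.1.Dom, a.1 ∈ (v 0).1 → Q M a (v 1) → Q M a (v 2) →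
        Q M a (v 3) :=
      .all (.imp (.mem 0 1) (.imp (hQ' 0 2) (.imp (hQ' 0 3) (hQ' 0 4))))
    refine (UDef.elem hF hCM hCN j (scons k (scons (p Y) (scons (p Z) fun _ => p W)))).2 ?_ k' hk'
      hY hZ
    rintro ⟨x, hx⟩ hxk h1 h2
    obtain ⟨a, ha, rfl⟩ := Ordinal.mem_toZFSet_iff.1 hxk
    exact (hp W a ha hx).2 (h a ha ((hp Y a ha hx).1 h1) ((hp Z a ha hx).1 h2))
  have hcompl : ∀ Y Z : Set Ordinal.{u}, (∀ a < κ, a ∈ Y ↔ a ∉ Z) → (D Y ↔ ¬ D Z) := by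
    intro Y Z h
    have hF : FO C fun M v => ∀ a : M.1.Dom, a.1 ∈ (v 0).1 → (Q M a (v 1) ↔ ¬ Q M a (v 2)) :=
      .all (.imp (.mem 0 1) (.iff (hQ' 0 2) (.not (hQ' 0 3))))
    refine (UDef.elem hF hCM hCN j (scons k (scons (p Y) fun _ => p Z))).2 ?_ k' hk'
    rintro ⟨x, hx⟩ hxk
    obtain ⟨a, ha, rfl⟩ := Ordinal.mem_toZFSet_iff.1 hxk
    exact (hp Y a ha hx).trans ((h a ha).trans (not_congr (hp Z a ha hx)).symm)
  have hsing : ∀ Y : Set Ordinal.{u}, ∀ b < κ, (∀ a < κ, a ∈ Y → a = b) → ¬ D Y := by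
    intro Y b hb h hD
    have hF : FO C fun M v => ∀ a : M.1.Dom, a.1 ∈ (v 0).1 → Q M a (v 1) → a.1 = (v 2).1 :=
      .all (.imp (.mem 0 1) (.imp (hQ' 0 2) (.eq 0 3)))
    have h1 : κ.toZFSet = (j ⟨_, hltM b hb⟩).1 := by
      refine (UDef.elem hF hCM hCN j (scons k (scons (p Y) fun _ => ⟨_, hltM b hb⟩))).2 ?_ k' hk' hD
      rintro ⟨x, hx⟩ hxk h1
      obtain ⟨a, ha, rfl⟩ := Ordinal.mem_toZFSet_iff.1 hxk
      exact congrArg Ordinal.toZFSet (h a ha ((hp Y a ha hx).1 h1))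
    rw [hfix b hb] at h1
    exact hb.ne' (Ordinal.toZFSet_injective h1)
  -- Completeness in partition form: the value of `j(f)` at `κ` lies in `j(γ) = γ`, so it is a fixed
  -- ordinal `β`, and `f` equals `β` on a large set.
  have hpart : ∀ γ < κ, ∀ f : Ordinal.{u} → Ordinal.{u}, (∀ a < κ, f a < γ) →
      ∃ b < γ, D {a | f a = b} := by
    intro γ hγ f hf
    obtain ⟨r, q, hrq⟩ := hfun γ hγ f hf
    have hF : FO C fun M v => ∀ a : M.1.Dom, a.1 ∈ (v 0).1 → ∃ b : M.1.Dom, b.1 ∈ (v 1).1 ∧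
        R M a b (v 2) (v 3) :=
      .all (.imp (.mem 0 1) (.ex (.and (.mem 0 3) (hR' 1 0 4 5))))
    obtain ⟨b, hb, hb'⟩ := (UDef.elem hF hCM hCN j
      (scons k (scons ⟨_, hltM γ hγ⟩ (scons r fun _ => q)))).2 (by
        rintro ⟨x, hx⟩ hxk
        obtain ⟨a, ha, rfl⟩ := Ordinal.mem_toZFSet_iff.1 hxk
        exact ⟨⟨_, hltM _ ((hf a ha).trans hγ)⟩, Ordinal.toZFSet_mem_toZFSet_iff.2 (hf a ha),
          (hrq a ha (f a) (hf a ha) hx _).2 rfl⟩) k' hk'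
    change b.1 ∈ (j ⟨_, hltM γ hγ⟩).1 at hb
    rw [hfix γ hγ] at hb
    obtain ⟨β, hβ, hβb⟩ := Ordinal.mem_toZFSet_iff.1 hb
    have hβM := hltM β (hβ.trans hγ)
    have hbj : b = j ⟨_, hβM⟩ := Subtype.ext (by rw [hfix β (hβ.trans hγ), hβb])
    subst hbj
    refine ⟨β, hβ, ?_⟩
    have hF' : FO C fun M v => ∀ a : M.1.Dom, a.1 ∈ (v 0).1 → R M a (v 1) (v 2) (v 3) →
        Q M a (v 4) :=
      .all (.imp (.mem 0 1) (.imp (hR' 0 2 3 4) (hQ' 0 5)))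
    refine (UDef.elem hF' hCM hCN j (scons k (scons ⟨_, hβM⟩ (scons r (scons q
      fun _ => p {a | f a = β}))))).2 ?_ k' hk' hb'
    rintro ⟨x, hx⟩ hxk h
    obtain ⟨a, ha, rfl⟩ := Ordinal.mem_toZFSet_iff.1 hxk
    exact (hp _ a ha hx).2 ((hrq a ha β hβ hx hβM).1 h)
  have h0κ : 0 < κ := Ordinal.omega0_pos.trans hω
  have hempty : ∀ Y : Set Ordinal.{u}, (∀ a < κ, a ∉ Y) → ¬ D Y := fun Y h =>
    hsing Y 0 h0κ fun a ha haY => (h a ha haY).elim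
  -- Otherwise an injection of `κ` into its smaller cardinality would be constant on a large set,
  -- making a singleton large.
  have hcard : κ.card.ord = κ := by
    refine (Cardinal.ord_card_le κ).eq_or_lt.resolve_right fun hlt => ?_
    have hc : #(Set.Iio κ) = #(Set.Iio κ.card.ord) := by
      rw [mk_Iio_ordinal, mk_Iio_ordinal, card_ord]
    obtain ⟨g⟩ := Cardinal.eq.1 hc
    obtain ⟨b, hb, hD⟩ := hpart _ hlt (fun a => if h : a < κ then (g ⟨a, h⟩).1 else 0)
      fun a ha => by simp only [ha, dite_true]; exact (g ⟨a, ha⟩).2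
    have hb' : (g.symm ⟨b, hb⟩).1 < κ := (g.symm ⟨b, hb⟩).2
    refine hsing _ (g.symm ⟨b, hb⟩).1 hb' (fun a ha h => ?_) hD
    simp only [Set.mem_ofPred_eq, ha, dite_true] at h
    have : g ⟨a, ha⟩ = ⟨b, hb⟩ := Subtype.ext h
    rw [← this, Equiv.symm_apply_apply]
  have hinf : ℵ₀ < κ.card := by
    have := hω
    rwa [← hcard, lt_ord, Ordinal.card_omega0] at this
  refine ⟨κ.card, hcard, hinf, κ.ToType, mk_toType κ, ?_⟩
  let e : Set κ.ToType → Set Ordinal.{u} := fun S => {a | ∃ h : a < κ, Ordinal.ToType.mk ⟨a, h⟩ ∈ S}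
  have he : ∀ S a (h : a < κ), a ∈ e S ↔ Ordinal.ToType.mk ⟨a, h⟩ ∈ S := fun S a h =>
    ⟨fun ⟨_, h⟩ => h, fun h' => ⟨h, h'⟩⟩
  let F : Filter κ.ToType :=
    { sets := {S | D (e S)}
      univ_sets := by
        by_contra h
        exact hempty (e Set.univ)ᶜ (fun a ha h => h ((he _ a ha).2 trivial))
          ((hcompl _ (e Set.univ) fun a _ => Iff.rfl).2 h)
      sets_of_superset := fun {S T} hS hST =>
        hinter _ _ _ (fun a ha h _ => (he _ a ha).2 (hST ((he _ a ha).1 h))) hS hS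
      inter_sets := fun {S T} hS hT =>
        hinter _ _ _ (fun a ha h h' => (he _ a ha).2 ⟨(he _ a ha).1 h, (he _ a ha).1 h'⟩) hS hT }
  have hF : ∀ S, S ∈ F ↔ D (e S) := fun S => Iff.rfl
  refine ⟨Ultrafilter.ofComplNotMemIff F fun S => ?_, ⟨fun S hS hSF => ?_⟩, fun x hx => ?_⟩
  · rw [hF, hF]
    exact (hcompl _ _ fun a ha => by rw [he _ a ha, he _ a ha]; simp).symm
  · have hS' : (#S).ord < κ := (ord_lt_ord.2 hS).trans_le hcard.le
    have hlim : Order.IsSuccLimit κ := by rw [← hcard]; exact isSuccLimit_ord hinf.le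
    have hc : #S = #((#S).ord.ToType) := (mk_ord_toType _).symm
    obtain ⟨g⟩ := Cardinal.eq.1 hc
    let i : S → Ordinal.{u} := fun s => (Ordinal.ToType.mk.symm (g s)).1
    have hi : ∀ s, i s < (#S).ord := fun s => (Ordinal.ToType.mk.symm (g s)).2
    have hinj : Function.Injective i := fun s t h =>
      g.injective (Ordinal.ToType.mk.symm.injective (Subtype.ext h))
    classical
    -- `f a` is the index of a member of `S` omitting `a`; the extra value `(#S).ord` means that
    -- none does. If the value on a large set is an index, that set is disjoint from a large member
    -- of `S`, which is absurd; so it is the extra one, and the intersection is large.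
    let f : Ordinal.{u} → Ordinal.{u} := fun a =>
      if h : ∃ s : S, a ∉ e s.1 then i h.choose else (#S).ord
    have hf : ∀ a < κ, f a < (#S).ord + 1 := fun a _ => by
      rw [Order.lt_add_one_iff]
      simp only [f]
      split
      · exact (hi _).le
      · exact le_rfl
    obtain ⟨b, hb, hD⟩ := hpart _ (hlim.add_one_lt hS') f hf
    have key : ∀ s : S, ∀ a < κ, f a = i s → a ∉ e s.1 := fun s a ha h => by
      simp only [f] at h
      split at h
      · next h' =>
        have := hinj h
        exact this ▸ h'.choose_spec
      · exact absurd h (hi s).ne'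
    by_cases hbs : ∃ s, i s = b
    · obtain ⟨s, rfl⟩ := hbs
      refine (hempty ∅ (fun a _ h => h) ?_).elim
      exact hinter _ _ _ (fun a ha h h' => (key s a ha h h').elim) hD (hSF s.1 s.2)
    · refine (hF _).2 (hinter _ _ _ (fun a ha h _ => ?_) hD hD)
      rw [he _ a ha]
      intro s hs
      by_contra h'
      have hex : ∃ s : S, a ∉ e s.1 := ⟨⟨s, hs⟩, fun h => h' ((he _ a ha).1 h)⟩
      refine hbs ⟨hex.choose, ?_⟩
      have h : f a = b := h
      rw [← h]
      simp only [f, dif_pos hex]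
  · refine hsing _ (Ordinal.ToType.mk.symm x).1 (Ordinal.ToType.mk.symm x).2 (fun a ha h => ?_)
      ((hF _).1 hx)
    have h := (he _ a ha).1 h
    rw [← Set.mem_singleton_iff.1 h]
    simp

end CriticalPoint

end TransSpectra

namespace TransSpectra

open FirstOrder FirstOrder.Language

/-! ### Embeddings of models that code `𝒫(ρ)` -/

lemma CodesPowerset.card_eq {A : Set ZFSet.{u}} {ρ : Cardinal.{u}} {α : Ordinal.{u}}
    (h : CodesPowerset A ρ α) : α.card = 2 ^ ρ := by
  have := Cardinal.mk_congr h.equiv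
  rw [mk_powerset, mk_Iio_ordinal, mk_Iio_ordinal, card_ord, ← lift_two_power] at this
  exact lift_injective this

lemma CodesPowerset.ord_lt {A : Set ZFSet.{u}} {ρ : Cardinal.{u}} {α : Ordinal.{u}}
    (h : CodesPowerset A ρ α) : ρ.ord < α := by
  have := cantor ρ
  rw [← h.card_eq] at this
  by_contra! hle
  have h' := Ordinal.card_le_card hle
  rw [card_ord] at h'
  exact this.not_ge h'

lemma j_pair_pred {M N : SetStr.{u}} (hM : InsertClosed M) (hN : InsertClosed N) (j : M.ElemEmb N)
    {x y : M.Dom} : ZFSet.pair (j x).1 (j y).1 ∈ N.A ↔ ZFSet.pair x.1 y.1 ∈ M.A :=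
  UDef.elem (C := InsertClosed) (.predT (.pair (fun _ h => h) (.var 0) (.var 1))) hM hN j
    (scons x fun _ => y)

lemma j_levIn {M N : SetStr.{u}} (hM : InsertClosed M) (hN : InsertClosed N) (j : M.ElemEmb N)
    {x y : M.Dom} : LevIn N.A (j x).1 (j y).1 ↔ LevIn M.A x.1 y.1 :=
  UDef.elem (C := InsertClosed) (.levIn (fun _ h => h) (.var 0) (.var 1)) hM hN j
    (scons x fun _ => y)

section

variable {A : Set ZFSet.{u}} {ρ : Cardinal.{u}} {α : Ordinal.{u}} (hα : Order.IsSuccLimit α)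
  (hcode : CodesPowerset A ρ α) (ax : LAxioms (LStr A α)) {N : SetStr.{u}} (hN : InsertClosed N)
  {j : (LStr A α).ElemEmb N}
include hα hcode ax hN

/-- The subsets of `κ` need not be elements of the model: an ordinal `ξ` represents the set it
codes. A function is represented by the code of the image of its graph under the pairing function on
`ρ`. -/
lemma measurable_of_isCrit_LStr (hρ : ℵ₀ ≤ ρ) {κ : Ordinal.{u}} (hκρ : κ ≤ ρ.ord)
    (hκ : j.IsCrit κ) : ∃ μ : Cardinal.{u}, μ.ord = κ ∧ IsMeasurableCardinal μ := by
  have hM := insertClosed_LStr (A := A) hα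
  have hlt := hcode.ord_lt
  have hI : ∀ M : SetStr.{u}, InsertClosed M → InsertClosed M := fun _ h => h
  have hQ : FO InsertClosed.{u} fun M v => ZFSet.pair (v 1).1 (v 0).1 ∈ M.1.A :=
    .predT (.pair hI (.var 1) (.var 0))
  have hR : FO InsertClosed.{u} fun M v => ∃ c ∈ (v 3).1,
      PairIn M.1.A (v 3).1 (v 0).1 (v 1).1 c ∧ ZFSet.pair (v 2).1 c ∈ M.1.A :=
    .bex (fun _ h => h.trans) (.var 3) (.and (.pairIn hI (.var 4) (.var 1) (.var 2) (.var 0))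
      (.predT (.pair hI (.var 3) (.var 0))))
  refine isMeasurableCardinal_of_isCrit hM.trans hN.trans hκ hM hN
    (Q := fun M a p => ZFSet.pair p.1 a.1 ∈ M.1.A)
    (R := fun M a b p q => ∃ c ∈ q.1, PairIn M.1.A q.1 a.1 b.1 c ∧ ZFSet.pair p.1 c ∈ M.1.A)
    hQ hR (fun Y => ?_) fun γ hγ f hf => ?_
  · obtain ⟨ξ, hξ, hY⟩ := hcode.surjOn (show Y ∩ Set.Iio ρ.ord ∈ 𝒫 (Set.Iio ρ.ord) from
      Set.inter_subset_right)
    refine ⟨⟨ξ.toZFSet, toZFSet_mem_LL.2 hξ⟩, fun a ha _ => ?_⟩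
    have := Set.ext_iff.1 hY a
    change ZFSet.pair ξ.toZFSet a.toZFSet ∈ A ↔ a ∈ Y
    simpa [ha.trans_le hκρ] using this
  · obtain ⟨ξ, hξ, hY⟩ := hcode.surjOn (show {c : Ordinal.{u} | c < ρ.ord ∧ ∃ a < κ,
      PairIn A ρ.ord.toZFSet a.toZFSet (f a).toZFSet c.toZFSet} ∈ 𝒫 (Set.Iio ρ.ord) from
      fun c hc => hc.1)
    have hρM : ρ.ord.toZFSet ∈ LL A α := toZFSet_mem_LL.2 hlt
    refine ⟨⟨ξ.toZFSet, toZFSet_mem_LL.2 hξ⟩, ⟨ρ.ord.toZFSet, hρM⟩, fun a ha b hb haM hbM => ?_⟩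
    have hlim : Order.IsSuccLimit ρ.ord := isSuccLimit_ord hρ
    obtain ⟨htot, hinj⟩ := ax.pairing _ hρM
      (by rw [← Ordinal.toZFSet_zero, Ordinal.toZFSet_mem_toZFSet_iff]; exact hlim.bot_lt)
      (fun a ha => by
        obtain ⟨o, ho, rfl⟩ := Ordinal.mem_toZFSet_iff.1 ha
        rw [← Ordinal.toZFSet_add_one, Ordinal.toZFSet_mem_toZFSet_iff]
        exact hlim.add_one_lt ho)
    have hm : ∀ {o}, o < κ → o.toZFSet ∈ ρ.ord.toZFSet := fun ho =>
      Ordinal.toZFSet_mem_toZFSet_iff.2 (ho.trans_le hκρ)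
    have hYc : ∀ c : Ordinal.{u}, c < ρ.ord → (ZFSet.pair ξ.toZFSet c.toZFSet ∈ A ↔
        ∃ a < κ, PairIn A ρ.ord.toZFSet a.toZFSet (f a).toZFSet c.toZFSet) := fun c hc => by
      have := Set.ext_iff.1 hY c
      simpa [hc] using this
    constructor
    · rintro ⟨c, hc, h1, h2⟩
      obtain ⟨c, hc', rfl⟩ := Ordinal.mem_toZFSet_iff.1 hc
      obtain ⟨a', ha', h3⟩ := (hYc c hc').1 h2
      obtain ⟨h4, h5⟩ := hinj _ (hm ha') _ (hm ((hf a' ha').trans hγ)) _ (hm ha) _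
        (hm (hb.trans hγ)) _ hc h3 h1
      rw [← Ordinal.toZFSet_injective h4]
      exact Ordinal.toZFSet_injective h5
    · rintro rfl
      obtain ⟨c, hc, h1⟩ := htot _ (hm ha) _ (hm (hb.trans hγ))
      obtain ⟨c, hc', rfl⟩ := Ordinal.mem_toZFSet_iff.1 hc
      exact ⟨_, hc, h1, (hYc c hc').2 ⟨a, ha, h1⟩⟩

/-- For an ordinal `η` of `N`, the subset of `ρ` that it codes appears in the enumeration of `M` at
some `ξ`. As `j` fixes `ρ` and its elements, `j(ξ)` and `η` code the same set. Injectivity of the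
coding carries over to `N`, so `j(ξ) = η`. -/
lemma isTrivial_of_fixes_ordinals (axN : LAxioms N)
    (hfix : ∀ o ≤ ρ.ord, ∀ h : o.toZFSet ∈ LL A α, (j ⟨o.toZFSet, h⟩).1 = o.toZFSet) :
    j.IsTrivial := by
  have hM := insertClosed_LStr (A := A) hα
  have hlt := hcode.ord_lt
  have hT : ∀ M : SetStr.{u}, InsertClosed M → M.Transitive := fun _ h => h.trans
  have hI : ∀ M : SetStr.{u}, InsertClosed M → InsertClosed M := fun _ h => h
  have hρM : ρ.ord.toZFSet ∈ LL A α := toZFSet_mem_LL.2 hlt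
  obtain ⟨β, hβ⟩ := hN.trans.exists_hasHeight
  have hinj : FO InsertClosed.{u} fun M v => ∀ x ∈ M.1.X, x.IsOrdinal → ∀ y ∈ M.1.X,
      y.IsOrdinal → (∀ i ∈ (v 0).1, ZFSet.pair x i ∈ M.1.A ↔ ZFSet.pair y i ∈ M.1.A) → x = y :=
    .allX (.imp (.isOrdinal hT (.var 0)) (.allX (.imp (.isOrdinal hT (.var 0)) (.imp
      (.ball hT (.var 2) (.iff (.predT (.pair hI (.var 2) (.var 0)))
        (.predT (.pair hI (.var 1) (.var 0))))) (.eq 1 0)))))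
  have hinjN := (UDef.elem hinj hM hN j fun _ => ⟨_, hρM⟩).2 (by
    intro x hx hxo y hy hyo h
    obtain ⟨ξ, rfl⟩ := ZFSet.isOrdinal_iff_mem_range_toZFSet.1 hxo
    obtain ⟨η, rfl⟩ := ZFSet.isOrdinal_iff_mem_range_toZFSet.1 hyo
    refine congrArg _ (hcode.injOn (toZFSet_mem_LL.1 hx) (toZFSet_mem_LL.1 hy) ?_)
    refine Set.ext fun i => and_congr_right fun hi => ?_
    exact h _ (Ordinal.toZFSet_mem_toZFSet_iff.2 hi))
  simp only [hfix _ le_rfl hρM] at hinjN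
  have hsurj : ∀ η < β, ∃ (ξ : Ordinal.{u}) (h : ξ.toZFSet ∈ LL A α),
      (j ⟨ξ.toZFSet, h⟩).1 = η.toZFSet := by
    intro η hη
    obtain ⟨ξ, hξ, hY⟩ := hcode.surjOn (show {i : Ordinal.{u} | i < ρ.ord ∧
      ZFSet.pair η.toZFSet i.toZFSet ∈ N.A} ∈ 𝒫 (Set.Iio ρ.ord) from fun i hi => hi.1)
    have hξM : ξ.toZFSet ∈ LL A α := toZFSet_mem_LL.2 hξ
    refine ⟨ξ, hξM, hinjN _ (j _).2 ((j_isOrdinal j hM.trans hN.trans).2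
      (ZFSet.isOrdinal_toZFSet ξ)) _ ((hβ η).2 hη) (ZFSet.isOrdinal_toZFSet η) fun i hi => ?_⟩
    obtain ⟨o, ho, rfl⟩ := Ordinal.mem_toZFSet_iff.1 hi
    have hoM : o.toZFSet ∈ LL A α := toZFSet_mem_LL.2 (ho.trans hlt)
    have h1 := j_pair_pred hM hN j (x := ⟨_, hξM⟩) (y := ⟨_, hoM⟩)
    rw [hfix o ho.le hoM] at h1
    refine h1.trans ?_
    have h2 := Set.ext_iff.1 hY o
    change ZFSet.pair ξ.toZFSet o.toZFSet ∈ A ↔ _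
    simpa [ho] using h2
  -- A critical point is an ordinal of `N` outside the range of `j`, contradicting surjectivity on
  -- ordinals.
  have hord : ∀ (o : Ordinal.{u}) (h : o.toZFSet ∈ LL A α), (j ⟨o.toZFSet, h⟩).1 = o.toZFSet := by
    by_contra! hne
    obtain ⟨o, hoM, hne⟩ := hne
    obtain ⟨κ, -, hκ⟩ := exists_isCrit hoM hne
    have hmem := hκ.mem hM.trans hN.trans
    have hκN : κ < β := (hβ κ).1 (hN.trans.mem_trans hmem (j _).2)
    obtain ⟨η, hηM, hη⟩ := hsurj κ hκN
    rcases lt_trichotomy η κ with h | rfl | h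
    · rw [hκ.2 η h hηM] at hη
      exact h.ne (Ordinal.toZFSet_injective hη)
    · rw [hη] at hmem
      exact ZFSet.mem_irrefl _ hmem
    · have h1 := (j_mem j (x := ⟨_, hκ.1.1⟩) (y := ⟨_, hηM⟩)).2
        (Ordinal.toZFSet_mem_toZFSet_iff.2 h)
      rw [hη] at h1
      exact ZFSet.mem_asymm hmem h1
  have hαβ : α = β := by
    refine eq_of_forall_lt_iff fun o => ⟨fun h => ?_, fun h => ?_⟩
    · have hoM : o.toZFSet ∈ LL A α := toZFSet_mem_LL.2 h
      rw [← hβ o, ← hord o hoM]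
      exact (j _).2
    · obtain ⟨ξ, hξM, hξ⟩ := hsurj o h
      rw [hord ξ hξM] at hξ
      rw [← Ordinal.toZFSet_injective hξ]
      exact toZFSet_mem_LL.1 hξM
  subst hαβ
  -- Both claims need a joint induction. The element `j(x)` lies in level `γ` of `N`, so its
  -- elements lie in earlier levels, which agree with those of `M` and are fixed by `j`. Once `j` is
  -- the identity on level `γ`, the two predicates agree there.
  have hlev : ∀ γ < α, LL A γ = LL N.A γ ∧
      ∀ x ∈ LL A γ, ∀ h : x ∈ LL A α, (j ⟨x, h⟩).1 = x := by
    intro γ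
    induction γ using WellFoundedLT.induction with
    | ind γ ih =>
      intro hγ
      have hγM : γ.toZFSet ∈ LL A α := toZFSet_mem_LL.2 hγ
      have hid : ∀ x ∈ LL A γ, ∀ h : x ∈ LL A α, (j ⟨x, h⟩).1 = x := by
        intro x hx h
        have h1 : (j ⟨x, h⟩).1 ∈ LL N.A γ := by
          have h2 := (LAxioms.lev_spec hN axN γ ((hβ γ).2 hγ)).1 _ (j ⟨x, h⟩).2
          have h3 := (LAxioms.lev_spec hM ax γ hγM).1 x h
          rw [← h2, ← hord γ hγM]
          exact (j_levIn hM hN j (x := ⟨_, hγM⟩) (y := ⟨x, h⟩)).2 (h3.2 hx)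
        obtain ⟨δ, hδ, hδx⟩ := mem_LL.1 h1
        obtain ⟨ε, hε, hεx⟩ := mem_LL.1 hx
        ext z
        constructor
        · intro hz
          have hzδ := (mem_DefPow.1 hδx).1 hz
          rw [← (ih δ hδ (hδ.trans hγ)).1] at hzδ
          have hzM := LL_mono (hδ.trans hγ).le hzδ
          rw [← (ih δ hδ (hδ.trans hγ)).2 z hzδ hzM] at hz
          exact (j_mem j (x := ⟨z, hzM⟩)).1 hz
        · intro hz
          have hzε := (mem_DefPow.1 hεx).1 hz
          have hzM := LL_mono (hε.trans hγ).le hzε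
          have h2 := (j_mem j (x := ⟨z, hzM⟩) (y := ⟨x, h⟩)).2 hz
          rwa [(ih ε hε (hε.trans hγ)).2 z hzε hzM] at h2
      refine ⟨LL_congr fun x hx => ?_, hid⟩
      have hxM := LL_mono hγ.le hx
      have := j_pred j (x := ⟨x, hxM⟩)
      rw [hid x hx hxM] at this
      exact this.symm
  have hid : ∀ x (h : x ∈ LL A α), (j ⟨x, h⟩).1 = x := fun x h => by
    obtain ⟨γ, hγ, hx⟩ := exists_mem_LL_of_isSuccLimit hα h
    exact (hlev γ hγ).2 x hx h
  refine ⟨?_, fun x => hid x.1 x.2⟩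
  rw [LAxioms.eq_LL hN axN hβ]
  refine (LL_congr fun x hx => ?_).symm
  have := j_pred j (x := ⟨x, hx⟩)
  rw [hid x hx] at this
  exact this.symm

/-- Non-trivial embeddings of a model that codes `𝒫(ρ)` have measurable critical points `≤ ρ`. -/
theorem exists_measurable_crit_LStr (hρ : ℵ₀ ≤ ρ) (axN : LAxioms N) (hj : ¬ j.IsTrivial) :
    ∃ κ : Cardinal.{u}, κ ≤ ρ ∧ IsMeasurableCardinal κ ∧ j.IsCrit κ.ord := by
  by_contra hne
  refine hj (isTrivial_of_fixes_ordinals hα hcode ax hN axN fun o ho h => ?_)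
  by_contra hmoved
  obtain ⟨κ, hκo, hκ⟩ := exists_isCrit h hmoved
  obtain ⟨μ, rfl, hμ⟩ := measurable_of_isCrit_LStr hα hcode ax hN hρ (hκo.trans ho) hκ
  exact hne ⟨μ, ord_le_ord.1 (hκo.trans ho), hμ, hκ⟩

end

end TransSpectra

namespace TransSpectra

open FirstOrder FirstOrder.Language

/-! ### The structures `H(ρ⁺)` -/

/-- Start with an element of rank at least `o` and descend along `∈`; transitivity keeps the descent
inside `t`. -/
lemma exists_rank_eq {t : ZFSet.{u}} (ht : t.IsTransitive) {o : Ordinal.{u}} (ho : o < t.rank) :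
    ∃ y ∈ t, y.rank = o := by
  obtain ⟨y, hy, hoy⟩ := ZFSet.lt_rank_iff.1 ho
  induction y using ZFSet.inductionOn with
  | h y ih =>
    rcases hoy.eq_or_lt with h | h
    · exact ⟨y, hy, h.symm⟩
    · obtain ⟨z, hz, hoz⟩ := ZFSet.lt_rank_iff.1 h
      exact ih z hz (ht.mem_trans hz hy) hoz

lemma card_rank_le {t : ZFSet.{u}} (ht : t.IsTransitive) : t.rank.card ≤ t.card := by
  rw [← lift_le.{u + 1}, ← mk_Iio_ordinal, ← ZFSet.cardinalMk_coe_sort]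
  refine mk_le_of_injective (f := fun o : Set.Iio t.rank =>
    (⟨_, (exists_rank_eq ht o.2).choose_spec.1⟩ : {y // y ∈ t})) fun o o' h => Subtype.ext ?_
  have h1 := (exists_rank_eq ht o.2).choose_spec.2
  have h2 := (exists_rank_eq ht o'.2).choose_spec.2
  rw [← h1, ← h2]
  exact congrArg (fun y => y.1.rank) h

/-- The rank bound in `HH` is automatic: the ranks of elements of a transitive set fill its rank, so
its cardinality bounds that of its rank. -/
lemma mem_HH {θ : Cardinal.{u}} {x : ZFSet.{u}} :
    x ∈ HH θ ↔ ∃ t : ZFSet.{u}, t.IsTransitive ∧ x ⊆ t ∧ t.card < θ := by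
  rw [HH, ZFSet.mem_sep, and_iff_right_iff_imp]
  rintro ⟨t, ht, hxt, hc⟩
  rw [ZFSet.mem_vonNeumann]
  refine (ZFSet.rank_mono hxt).trans_lt ?_
  rw [lt_ord]
  exact (card_rank_le ht).trans_lt hc

lemma HH_transitive (θ : Cardinal.{u}) : (HH θ).IsTransitive := fun x hx y hy => by
  obtain ⟨t, ht, hxt, hc⟩ := mem_HH.1 hx
  exact mem_HH.2 ⟨t, ht, ht.subset_of_mem (hxt hy), hc⟩

lemma toZFSet_mem_HH {θ : Cardinal.{u}} {o : Ordinal.{u}} (ho : o < θ.ord) : o.toZFSet ∈ HH θ :=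
  mem_HH.2 ⟨_, (ZFSet.isOrdinal_toZFSet o).isTransitive, subset_rfl, by
    rw [Ordinal.card_toZFSet, ← lt_ord]; exact ho⟩

variable {ρ : Cardinal.{u}}

lemma card_le_of_mem_HH {x : ZFSet.{u}} (hx : x ∈ HH (Order.succ ρ)) : x.card ≤ ρ := by
  obtain ⟨t, -, hxt, hc⟩ := mem_HH.1 hx
  exact (ZFSet.card_mono hxt).trans (Order.lt_succ_iff.1 hc)

/-- Adjoin to `x` transitive covers of its elements: a union of at most `ρ` sets of size at most
`ρ`. -/
lemma mem_HH_of_subset (hρ : ℵ₀ ≤ ρ) {x : ZFSet.{u}} (hx : x ⊆ HH (Order.succ ρ))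
    (hc : x.card ≤ ρ) : x ∈ HH (Order.succ ρ) := by
  have h : ∀ y : {y // y ∈ x}, ∃ t : ZFSet.{u}, t.IsTransitive ∧ y.1 ⊆ t ∧ t.card ≤ ρ := fun y => by
    obtain ⟨t, h1, h2, h3⟩ := mem_HH.1 (hx y.2)
    exact ⟨t, h1, h2, Order.lt_succ_iff.1 h3⟩
  choose t ht hsub hcard using h
  refine mem_HH.2 ⟨x ∪ ZFSet.iUnion t, ?_, fun y hy => ZFSet.mem_union.2 (Or.inl hy), ?_⟩
  · intro y hy z hz
    rw [ZFSet.mem_union] at hy ⊢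
    right
    rw [ZFSet.mem_iUnion]
    rcases hy with hy | hy
    · exact ⟨⟨y, hy⟩, hsub ⟨y, hy⟩ hz⟩
    · obtain ⟨i, hi⟩ := ZFSet.mem_iUnion.1 hy
      exact ⟨i, (ht i).mem_trans hz hi⟩
  · rw [Order.lt_succ_iff]
    refine (ZFSet.card_union_le).trans ((add_le_add hc ?_).trans (add_eq_self hρ).le)
    rw [← lift_le.{u + 1}]
    refine (ZFSet.lift_card_iUnion_le_sum_card).trans ((sum_le_sum _ _ hcard).trans ?_)
    rw [sum_const]
    have h1 : #{y // y ∈ x} = lift.{u + 1} x.card := ZFSet.cardinalMk_coe_sort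
    rw [h1, lift_lift, ← lift_mul, lift_le]
    exact (mul_le_mul_left hc ρ).trans (mul_eq_self hρ).le

lemma range_mem_HH (hρ : ℵ₀ ≤ ρ) {ι : Type*} [Small.{u} ι] {f : ι → ZFSet.{u}}
    (hf : ∀ i, f i ∈ HH (Order.succ ρ)) (hι : #(Shrink.{u} ι) ≤ ρ) :
    ZFSet.range f ∈ HH (Order.succ ρ) := by
  refine mem_HH_of_subset hρ (fun x hx => ?_) ?_
  · obtain ⟨i, rfl⟩ := ZFSet.mem_range.1 hx
    exact hf i
  · have h : ZFSet.range f = ZFSet.range (fun i : Shrink.{u} ι => f ((equivShrink ι).symm i)) := by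
      ext x
      simp [ZFSet.mem_range, (equivShrink ι).symm.surjective.exists]
    rw [h]
    have := ZFSet.lift_card_range_le (f := fun i : Shrink.{u} ι => f ((equivShrink ι).symm i))
    rw [lift_id, lift_id] at this
    exact this.trans hι

lemma insertClosed_HH (hρ : ℵ₀ ≤ ρ) (A : Set ZFSet.{u}) : InsertClosed ⟨HH (Order.succ ρ), A⟩ where
  trans := HH_transitive _
  empty := mem_HH.2 ⟨∅, ZFSet.isTransitive_empty, subset_rfl, by simp⟩
  insert {x y} hx hy := by
    refine mem_HH_of_subset hρ (fun z hz => ?_) (ZFSet.card_insert_le.trans ?_)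
    · rcases ZFSet.mem_insert_iff.1 hz with rfl | hz
      · exact hx
      · exact (HH_transitive _).mem_trans hz hy
    · exact (add_le_add (card_le_of_mem_HH hy) (one_le_aleph0.trans hρ)).trans (add_eq_self hρ).le

lemma card_le_iff_exists_injOn {x : ZFSet.{u}} :
    x.card ≤ ρ ↔ ∃ e : {y // y ∈ x} → Set.Iio ρ.ord, Function.Injective e := by
  rw [← lift_le.{u + 1}, ← ZFSet.cardinalMk_coe_sort, ← card_ord ρ, ← mk_Iio_ordinal, card_ord]
  exact ⟨fun ⟨e⟩ => ⟨e, e.injective⟩, fun ⟨e, he⟩ => ⟨⟨e, he⟩⟩⟩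

/-- Non-trivial embeddings of `H(ρ⁺)` have measurable critical points `≤ ρ`. -/
theorem measurableCrit_HH (hρ : ℵ₀ ≤ ρ) (A : Set ZFSet.{u}) :
    MeasurableCrit ⟨HH (Order.succ ρ), A⟩ ρ := by
  intro N hNt j hj
  have hM := insertClosed_HH hρ A
  have hI : ∀ M : SetStr.{u}, InsertClosed M → InsertClosed M := fun _ h => h
  have hT : ∀ M : SetStr.{u}, InsertClosed M → M.Transitive := fun _ h => h.trans
  have hN : InsertClosed N := by
    have h : FO SetStr.Transitive.{u} fun M _ => (∃ x ∈ M.1.X, ∀ y ∈ x, False) ∧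
        ∀ x ∈ M.1.X, ∀ y ∈ M.1.X, ∃ z ∈ M.1.X, z = insert x y :=
      .and (.exX (.ball (fun _ h => h) (.var 0) (.const False)))
        (.allX (.allX (.exX (.eq_insert (fun _ h => h) 0 2 1))))
    obtain ⟨⟨x, hx, hx'⟩, h⟩ := (UDef.elem h hM.trans hNt j fun _ => ⟨∅, hM.empty⟩).2
      ⟨⟨∅, hM.empty, by simp⟩, fun x hx y hy => ⟨_, hM.insert hx hy, rfl⟩⟩
    obtain rfl := (ZFSet.eq_empty x).2 hx'
    exact ⟨hNt, hx, fun {x y} hx hy => by obtain ⟨z, hz, rfl⟩ := h x hx y hy; exact hz⟩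
  have hordM : ∀ {o : Ordinal.{u}}, o ≤ ρ.ord → o.toZFSet ∈ HH (Order.succ ρ) := fun h =>
    toZFSet_mem_HH (h.trans_lt (ord_lt_ord.2 (Order.lt_succ ρ)))
  have hmeas : ∀ κ ≤ ρ.ord, j.IsCrit κ → ∃ μ : Cardinal.{u}, μ.ord = κ ∧ IsMeasurableCardinal μ := by
    intro κ hκρ hκ
    have hκc : κ.card ≤ ρ := by simpa using Ordinal.card_le_card hκρ
    refine isMeasurableCardinal_of_isCrit hM.trans hN.trans hκ hM hN
      (Q := fun M a p => a.1 ∈ p.1) (R := fun M a b p _ => ZFSet.pair a.1 b.1 ∈ p.1)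
      (.mem 0 1) (.memT (.pair hI (.var 0) (.var 1)) (.var 2)) (fun Y => ?_) fun γ hγ f hf => ?_
    · refine ⟨⟨κ.toZFSet.sep fun a => ∃ o ∈ Y, o.toZFSet = a, ?_⟩, fun a ha _ => ?_⟩
      · refine mem_HH_of_subset hρ (ZFSet.sep_subset.trans ((HH_transitive _) _ (hordM hκρ))) ?_
        refine (ZFSet.card_mono ZFSet.sep_subset).trans ?_
        rwa [Ordinal.card_toZFSet]
      · simp only [ZFSet.mem_sep, Ordinal.toZFSet_mem_toZFSet_iff, ha, true_and]
        exact ⟨fun ⟨o, ho, h⟩ => Ordinal.toZFSet_injective h ▸ ho, fun h => ⟨a, h, rfl⟩⟩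
    · have hp : ZFSet.range (fun a : Set.Iio κ => ZFSet.pair a.1.toZFSet (f a.1).toZFSet) ∈
          HH (Order.succ ρ) := by
        refine range_mem_HH hρ (fun a => ?_) ?_
        · have ha : a.1 < κ := a.2
          exact hM.pair (hordM (ha.le.trans hκρ)) (hordM (((hf _ ha).trans hγ).le.trans hκρ))
        · rw [← lift_le.{u + 1}, lift_mk_shrink'', mk_Iio_ordinal, lift_le]
          exact hκc
      refine ⟨⟨_, hp⟩, ⟨_, hp⟩, fun a ha b hb _ _ => ?_⟩
      simp only [ZFSet.mem_range, ZFSet.pair_inj]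
      constructor
      · rintro ⟨⟨a', ha'⟩, h1, h2⟩
        rw [← Ordinal.toZFSet_injective h1]
        exact Ordinal.toZFSet_injective h2
      · rintro rfl
        exact ⟨⟨a, ha⟩, rfl, rfl⟩
  by_contra hne
  have hfix : ∀ o ≤ ρ.ord, ∀ h : o.toZFSet ∈ HH (Order.succ ρ),
      (j ⟨o.toZFSet, h⟩).1 = o.toZFSet := by
    intro o ho h
    by_contra hmoved
    obtain ⟨κ, hκo, hκ⟩ := exists_isCrit h hmoved
    obtain ⟨μ, rfl, hμ⟩ := hmeas κ (hκo.trans ho) hκ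
    exact hne ⟨μ, ord_le_ord.1 (hκo.trans ho), hμ, hκ⟩
  have hρM := hordM (le_refl ρ.ord)
  have hfun : FO InsertClosed.{u} fun M v => (∀ i ∈ M.1.X, ∀ y ∈ M.1.X, ∀ z ∈ M.1.X,
      ZFSet.pair i y ∈ (v 1).1 → ZFSet.pair i z ∈ (v 1).1 → y = z) ∧
      ∀ y ∈ (v 0).1, ∃ i ∈ (v 2).1, ZFSet.pair i y ∈ (v 1).1 :=
    .and (.allX (.allX (.allX (.imp (.memT (.pair hI (.var 2) (.var 1)) (.var 4))
      (.imp (.memT (.pair hI (.var 2) (.var 0)) (.var 4)) (.eq 1 0))))))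
      (.ball hT (.var 0) (.bex hT (.var 3) (.memT (.pair hI (.var 0) (.var 1)) (.var 3))))
  have hexM : ∀ x ∈ HH (Order.succ ρ), ∃ f ∈ HH (Order.succ ρ),
      (∀ i ∈ HH (Order.succ ρ), ∀ y ∈ HH (Order.succ ρ), ∀ z ∈ HH (Order.succ ρ),
        ZFSet.pair i y ∈ f → ZFSet.pair i z ∈ f → y = z) ∧
      ∀ y ∈ x, ∃ i ∈ ρ.ord.toZFSet, ZFSet.pair i y ∈ f := by
    intro x hx
    obtain ⟨e, he⟩ := card_le_iff_exists_injOn.1 (card_le_of_mem_HH hx)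
    refine ⟨ZFSet.range fun y : {y // y ∈ x} => ZFSet.pair (e y).1.toZFSet y.1,
      range_mem_HH hρ (fun y => ?_) (card_le_of_mem_HH hx), ?_, fun y hy => ?_⟩
    · exact hM.pair (hordM (show (e y).1 < ρ.ord from (e y).2).le)
        ((HH_transitive _).mem_trans y.2 hx)
    · intro i _ y _ z _ h1 h2
      obtain ⟨a, ha⟩ := ZFSet.mem_range.1 h1
      obtain ⟨b, hb⟩ := ZFSet.mem_range.1 h2
      rw [ZFSet.pair_inj] at ha hb
      rw [← ha.2, ← hb.2, he (Subtype.ext (Ordinal.toZFSet_injective (ha.1.trans hb.1.symm)))]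
    · exact ⟨_, Ordinal.toZFSet_mem_toZFSet_iff.2 (e ⟨y, hy⟩).2,
        ZFSet.mem_range.2 ⟨⟨y, hy⟩, rfl⟩⟩
  have hid : ∀ x, ∀ h : x ∈ HH (Order.succ ρ), (j ⟨x, h⟩).1 = x := by
    intro x
    induction x using ZFSet.inductionOn with
    | h x ih =>
      intro hx
      obtain ⟨f, hf, hff⟩ := hexM x hx
      have hN' := (UDef.elem hfun hM hN j
        (scons ⟨x, hx⟩ (scons ⟨f, hf⟩ fun _ => ⟨_, hρM⟩))).2 hff
      change (∀ i ∈ N.X, ∀ y ∈ N.X, ∀ z ∈ N.X, ZFSet.pair i y ∈ (j ⟨f, hf⟩).1 →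
        ZFSet.pair i z ∈ (j ⟨f, hf⟩).1 → y = z) ∧
        ∀ y ∈ (j ⟨x, hx⟩).1, ∃ i ∈ (j ⟨_, hρM⟩).1, ZFSet.pair i y ∈ (j ⟨f, hf⟩).1 at hN'
      ext z
      constructor
      · intro hz
        obtain ⟨i, hi, hiz⟩ := hN'.2 z hz
        rw [hfix _ le_rfl hρM] at hi
        obtain ⟨o, ho, rfl⟩ := Ordinal.mem_toZFSet_iff.1 hi
        have hoM := hordM ho.le
        -- An element `z` of `j(x)` has a fixed index `i` under `j(f)`. Pulled back, `i` indexes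
        -- some `y ∈ x` under `f`, and `j(y) = y` by induction; functionality of `j(f)` gives `z =
        -- y`.
        have hF : FO InsertClosed.{u} fun M v => ∃ y ∈ (v 0).1, ZFSet.pair (v 1).1 y ∈ (v 2).1 :=
          .bex hT (.var 0) (.memT (.pair hI (.var 2) (.var 0)) (.var 3))
        obtain ⟨y, hy, hy'⟩ := (UDef.elem hF hM hN j
          (scons ⟨x, hx⟩ (scons ⟨_, hoM⟩ fun _ => ⟨f, hf⟩))).1 ⟨z, hz, by
            change ZFSet.pair (j ⟨_, hoM⟩).1 z ∈ (j ⟨f, hf⟩).1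
            rw [hfix o ho.le hoM]
            exact hiz⟩
        have hyM : y ∈ HH (Order.succ ρ) := (HH_transitive _).mem_trans hy hx
        have hF' : FO InsertClosed.{u} fun M v => ZFSet.pair (v 0).1 (v 1).1 ∈ (v 2).1 :=
          .memT (.pair hI (.var 0) (.var 1)) (.var 2)
        have h1 : ZFSet.pair (j ⟨_, hoM⟩).1 (j ⟨y, hyM⟩).1 ∈ (j ⟨f, hf⟩).1 :=
          (UDef.elem hF' hM hN j (scons ⟨_, hoM⟩ (scons ⟨y, hyM⟩ fun _ => ⟨f, hf⟩))).2 hy'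
        rw [hfix o ho.le hoM, ih y hy hyM] at h1
        have hfN := (j ⟨f, hf⟩).2
        have h2 := hN.of_pair (hN.trans.mem_trans hiz hfN)
        have h3 := hN.of_pair (hN.trans.mem_trans h1 hfN)
        rw [hN'.1 _ h2.1 _ h2.2 _ h3.2 hiz h1]
        exact hy
      · intro hz
        have hzM : z ∈ HH (Order.succ ρ) := (HH_transitive _).mem_trans hz hx
        have := (j_mem j (x := ⟨z, hzM⟩) (y := ⟨x, hx⟩)).2 hz
        rwa [ih z hz hzM] at this
  refine hj ⟨?_, fun x => hid x.1 x.2⟩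
  ext n
  refine ⟨fun hn => ?_, fun hn => ?_⟩
  -- By elementarity each element of `N` is enumerated by ordinals below `j(ρ) = ρ`, so
  -- `∈`-induction places it in `H(ρ⁺)`.
  · have hall : FO InsertClosed.{u} fun M v => ∀ x ∈ M.1.X, ∃ f ∈ M.1.X,
        (∀ i ∈ M.1.X, ∀ y ∈ M.1.X, ∀ z ∈ M.1.X,
          ZFSet.pair i y ∈ f → ZFSet.pair i z ∈ f → y = z) ∧
        ∀ y ∈ x, ∃ i ∈ (v 0).1, ZFSet.pair i y ∈ f :=
      .allX (.exX (.and (.allX (.allX (.allX (.imp (.memT (.pair hI (.var 2) (.var 1)) (.var 3))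
        (.imp (.memT (.pair hI (.var 2) (.var 0)) (.var 3)) (.eq 1 0))))))
        (.ball hT (.var 1) (.bex hT (.var 3) (.memT (.pair hI (.var 0) (.var 1)) (.var 2))))))
    have hexN := (UDef.elem hall hM hN j fun _ => ⟨_, hρM⟩).2 hexM
    simp only [hfix _ le_rfl hρM] at hexN
    induction n using ZFSet.inductionOn with
    | h n ih =>
      refine mem_HH_of_subset hρ (fun y hy => ih y hy (hN.trans.mem_trans hy hn)) ?_
      obtain ⟨f, hf, h1, h2⟩ := hexN n hn
      rw [card_le_iff_exists_injOn]
      have h3 : ∀ y : {y // y ∈ n}, ∃ i : Set.Iio ρ.ord, ZFSet.pair i.1.toZFSet y.1 ∈ f := by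
        rintro ⟨y, hy⟩
        obtain ⟨i, hi, h⟩ := h2 y hy
        obtain ⟨o, ho, rfl⟩ := Ordinal.mem_toZFSet_iff.1 hi
        exact ⟨⟨o, ho⟩, h⟩
      choose e he using h3
      refine ⟨e, fun y z hyz => Subtype.ext ?_⟩
      have hy := he y
      have hz := he z
      rw [← hyz] at hz
      exact h1 _ (hN.of_pair (hN.trans.mem_trans hy hf)).1 _ (hN.trans.mem_trans y.2 hn) _
        (hN.trans.mem_trans z.2 hn) hy hz
  · rw [← hid n hn]
    exact (j _).2

end TransSpectra

namespace TransSpectra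

open FirstOrder FirstOrder.Language

/-! ### Ultrapowers by countably complete ultrafilters -/

section Ultrapower

variable {M : SetStr.{u}} {X : Type u} (U : Ultrafilter X)

/-- The membership relation of the ultrapower, on representatives. -/
def UltraMem (M : SetStr.{u}) (f g : X → M.Dom) : Prop := ∀ᶠ x in (U : Filter X), (f x).1 ∈ (g x).1

/-- By countable completeness, a descending sequence modulo `U` descends at a single coordinate,
against well-foundedness of `∈`. -/
lemma ultraMem_wf (hU : CountableInterFilter (U : Filter X)) :
    WellFounded (UltraMem U M) := by
  rw [wellFounded_iff_isEmpty_descending_chain]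
  refine ⟨fun ⟨f, hf⟩ => ?_⟩
  have h : ∀ᶠ x in (U : Filter X), ∀ n, (f (n + 1) x).1 ∈ (f n x).1 :=
    eventually_countable_forall.2 hf
  obtain ⟨x, hx⟩ := h.exists
  exact (wellFounded_iff_isEmpty_descending_chain.1 ZFSet.mem_wf).false
    ⟨fun n => (f n x).1, hx⟩

instance : Small.{u} M.Dom := inferInstanceAs (Small.{u} {x : ZFSet.{u} // x ∈ M.X})

variable {U} (hU : CountableInterFilter (U : Filter X))

/-- The transitive collapse of the ultrapower, on representatives. -/
noncomputable def ultraCollapse : (X → M.Dom) → ZFSet.{u} :=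
  (ultraMem_wf U hU).fix fun g ih => ZFSet.range fun f : {f // UltraMem U M f g} => ih f.1 f.2

lemma mem_ultraCollapse {g : X → M.Dom} {y : ZFSet.{u}} :
    y ∈ ultraCollapse hU g ↔ ∃ f, UltraMem U M f g ∧ ultraCollapse hU f = y := by
  rw [ultraCollapse, WellFounded.fix_eq]
  simp

/-- If `f` and `g` differ almost everywhere, choose `c x` in their symmetric difference; almost
always it falls on the same side. Its collapse then belongs to both collapses, and the induction
hypothesis contradicts the choice of `c`. -/
lemma ultraCollapse_eq (hM : M.Transitive) {f g : X → M.Dom} :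
    ultraCollapse hU f = ultraCollapse hU g ↔ ∀ᶠ x in (U : Filter X), f x = g x := by
  constructor
  · induction f using (ultraMem_wf U hU).induction generalizing g with | _ f ih
    intro h
    by_contra hne
    rw [Ultrafilter.eventually_not.symm] at hne
    have key : ∀ᶠ x in (U : Filter X), ∃ z : M.Dom,
        z.1 ∈ (f x).1 ∧ z.1 ∉ (g x).1 ∨ z.1 ∉ (f x).1 ∧ z.1 ∈ (g x).1 := by
      filter_upwards [hne] with x hx
      by_contra! hz
      refine hx (Subtype.ext (ZFSet.ext fun z => ⟨fun h => ?_, fun h => ?_⟩))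
      · exact (hz ⟨z, hM.mem_trans h (f x).2⟩).1 h
      · by_contra h'
        exact (hz ⟨z, hM.mem_trans h (g x).2⟩).2 h' h
    obtain ⟨x₀, z₀, -⟩ := key.exists
    classical
    let c : X → M.Dom := fun x => if hx : ∃ z : M.Dom,
      z.1 ∈ (f x).1 ∧ z.1 ∉ (g x).1 ∨ z.1 ∉ (f x).1 ∧ z.1 ∈ (g x).1 then hx.choose else z₀
    have hc : ∀ᶠ x in (U : Filter X),
        (c x).1 ∈ (f x).1 ∧ (c x).1 ∉ (g x).1 ∨ (c x).1 ∉ (f x).1 ∧ (c x).1 ∈ (g x).1 := by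
      filter_upwards [key] with x hx
      simp only [c, dif_pos hx]
      exact hx.choose_spec
    rw [Ultrafilter.eventually_or] at hc
    rcases hc with hc | hc
    · have h1 : ultraCollapse hU c ∈ ultraCollapse hU g :=
        h ▸ (mem_ultraCollapse hU).2 ⟨c, hc.mono fun x hx => hx.1, rfl⟩
      obtain ⟨d, hd, hdc⟩ := (mem_ultraCollapse hU).1 h1
      have := ih c (hc.mono fun x hx => hx.1) hdc.symm
      obtain ⟨x, hx1, hx2, hx3⟩ := (hc.and (this.and hd)).exists
      exact hx1.2 (hx2 ▸ hx3)
    · have h1 : ultraCollapse hU c ∈ ultraCollapse hU f :=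
        h ▸ (mem_ultraCollapse hU).2 ⟨c, hc.mono fun x hx => hx.2, rfl⟩
      obtain ⟨d, hd, hdc⟩ := (mem_ultraCollapse hU).1 h1
      have := ih d hd hdc
      obtain ⟨x, hx1, hx2, hx3⟩ := (hc.and (this.and hd)).exists
      exact hx1.1 (hx2 ▸ hx3)
  · intro h
    refine ZFSet.ext fun y => ?_
    rw [mem_ultraCollapse, mem_ultraCollapse]
    refine exists_congr fun d => and_congr_left fun _ => ?_
    refine Filter.eventually_congr (h.mono fun x hx => ?_)
    rw [hx]

lemma ultraCollapse_mem (hM : M.Transitive) {f g : X → M.Dom} :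
    ultraCollapse hU f ∈ ultraCollapse hU g ↔ UltraMem U M f g := by
  rw [mem_ultraCollapse]
  refine ⟨fun ⟨d, hd, h⟩ => ?_, fun h => ⟨f, h, rfl⟩⟩
  filter_upwards [hd, (ultraCollapse_eq hU hM).1 h] with x h1 h2
  rwa [← h2]

/-- The transitive collapse of the ultrapower of `M`. -/
noncomputable def ultrapower (M : SetStr.{u}) : SetStr.{u} where
  X := ZFSet.range fun f : X → M.Dom => ultraCollapse hU f
  A := {y | ∃ f : X → M.Dom, ultraCollapse hU f = y ∧ ∀ᶠ x in (U : Filter X), (f x).1 ∈ M.A}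

lemma ultraCollapse_mem_ultrapower (f : X → M.Dom) : ultraCollapse hU f ∈ (ultrapower hU M).X :=
  ZFSet.mem_range.2 ⟨f, rfl⟩

lemma ultrapower_transitive : (ultrapower hU M).Transitive := by
  intro y hy z hz
  obtain ⟨g, rfl⟩ := ZFSet.mem_range.1 hy
  obtain ⟨f, -, rfl⟩ := (mem_ultraCollapse hU).1 hz
  exact ultraCollapse_mem_ultrapower hU f

/-- The isomorphism of the ultrapower onto its transitive collapse. -/
noncomputable def ultrapowerEquiv (hM : M.Transitive) :
    (U : Filter X).Product (fun _ => M.Dom) ≃[lang] (ultrapower hU M).Dom where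
  toEquiv := Equiv.ofBijective
    (Quotient.lift (fun f => (⟨_, ultraCollapse_mem_ultrapower hU f⟩ : (ultrapower hU M).Dom))
      fun _ _ h => Subtype.ext ((ultraCollapse_eq hU hM).2 h)) (by
      constructor
      · rintro ⟨f⟩ ⟨g⟩ h
        exact Quotient.sound ((ultraCollapse_eq hU hM).1 (congrArg Subtype.val h))
      · rintro ⟨y, hy⟩
        obtain ⟨f, rfl⟩ := ZFSet.mem_range.1 hy
        exact ⟨Quotient.mk _ f, rfl⟩)
  map_fun' f := Empty.elim f
  map_rel' {n} R v := by
    obtain ⟨w, rfl⟩ : ∃ w : Fin n → X → M.Dom, v = fun i => Quotient.mk _ (w i) :=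
      ⟨fun i => (v i).out, funext fun i => (Quotient.out_eq _).symm⟩
    refine Iff.trans ?_ (relMap_quotient_mk' (L := lang)
      (s := (U : Filter X).productSetoid fun _ => M.Dom)
      (ps := Ultraproduct.setoidPrestructure _ U) R w).symm
    cases R with
    | mem => exact ultraCollapse_mem hU hM
    | pred =>
      refine ⟨fun ⟨f, hf, h⟩ => ?_, fun h => ⟨_, rfl, h⟩⟩
      refine ((ultraCollapse_eq hU hM).1 hf).mp (h.mono fun x hx hxy => ?_)
      change ((w 0) x).1 ∈ M.A
      rwa [← hxy]

/-- The canonical embedding into the ultrapower. -/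
noncomputable def ultrapowerEmb (hM : M.Transitive) [Nonempty M.Dom] :
    M.ElemEmb (ultrapower hU M) where
  toFun a := ⟨_, ultraCollapse_mem_ultrapower hU fun _ => a⟩
  map_formula' n φ v := by
    -- Elementarity is Łoś's theorem for constant functions, transported along the collapse.
    have h1 := StrongHomClass.realize_formula (ultrapowerEquiv hU hM) φ
      (v := fun i => Quotient.mk _ fun _ => v i)
    have h2 := Ultraproduct.realize_formula_cast (u := U) φ fun i (_ : X) => v i
    refine Iff.trans (h1.trans h2) ?_
    simp

/-- An injection `g` of the index set into `κ` represents an element of `j(κ)`. If `j` were the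
identity, this would be some `ξ = j(ξ)` with `ξ < κ`; then `g` would be constant almost everywhere
and a singleton would be in the ultrafilter. -/
theorem not_isMaximal_of_measurable {κ : Cardinal.{u}} (hM : M.Transitive)
    (hκ : IsMeasurableCardinal κ) (hκM : κ.ord.toZFSet ∈ M.X) : ¬ M.IsMaximal := by
  intro hmax
  obtain ⟨h0, X, hX, U, hU, hnp⟩ := hκ
  have hUc : CountableInterFilter (U : Filter X) := CardinalInterFilter.toCountableInterFilter _ h0
  have : Nonempty M.Dom := ⟨⟨_, hκM⟩⟩
  obtain ⟨-, hid⟩ := hmax _ (ultrapower_transitive hUc) (ultrapowerEmb hUc hM)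
  obtain ⟨e⟩ : Nonempty (X ≃ κ.ord.ToType) := Cardinal.eq.1 (by simp [hX])
  let r : X → Ordinal.{u} := fun x => (Ordinal.ToType.mk.symm (e x)).1
  have hr : ∀ x, r x < κ.ord := fun x => (Ordinal.ToType.mk.symm (e x)).2
  have hrinj : Function.Injective r := fun x y h =>
    e.injective (Ordinal.ToType.mk.symm.injective (Subtype.ext h))
  have hrM : ∀ o < κ.ord, o.toZFSet ∈ M.X := fun o ho =>
    hM.mem_trans (Ordinal.toZFSet_mem_toZFSet_iff.2 ho) hκM
  let g : X → M.Dom := fun x => ⟨(r x).toZFSet, hrM _ (hr x)⟩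
  have hg : ultraCollapse hUc g ∈ ultraCollapse hUc fun _ => (⟨_, hκM⟩ : M.Dom) :=
    (ultraCollapse_mem hUc hM).2 (.of_forall fun x => Ordinal.toZFSet_mem_toZFSet_iff.2 (hr x))
  rw [show ultraCollapse hUc (fun _ => (⟨_, hκM⟩ : M.Dom)) = κ.ord.toZFSet from hid ⟨_, hκM⟩] at hg
  obtain ⟨ξ, hξ, hξg⟩ := Ordinal.mem_toZFSet_iff.1 hg
  have h := hξg.symm.trans (hid ⟨_, hrM ξ hξ⟩).symm
  have h := (ultraCollapse_eq hUc hM).1 h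
  obtain ⟨x, hx⟩ := h.exists
  refine hnp x (Filter.mem_of_superset h fun y hy => hrinj ?_)
  exact Ordinal.toZFSet_injective (congrArg Subtype.val ((hy : g y = _).trans hx.symm))

end Ultrapower

end TransSpectra

namespace TransSpectra

open FirstOrder FirstOrder.Language

/-! ### Spectra -/

lemma SetStr.models_singleton {M : SetStr.{u}} {σ : lang.Sentence} :
    M.Models {σ} ↔ M.Dom ⊨ σ :=
  Theory.model_singleton_iff

lemma SetStr.ElemEmb.models {M N : SetStr.{u}} (j : M.ElemEmb N) {T : lang.Theory}
    (h : M.Models T) : N.Models T :=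
  (j.theory_model_iff T).1 h

lemma isRecursiveTheory_singleton (σ : lang.Sentence) : IsRecursiveTheory {σ} := by
  have : (fun m : ℕ => ∃ φ ∈ ({σ} : lang.Theory), code φ = m) = fun m => m = code σ := by
    funext m
    simp [eq_comm]
  rw [IsRecursiveTheory, this]
  exact (PrimrecPred.computablePred (Primrec.eq.comp .id (.const _)))

lemma MeasurableCrit.isMaximal {M : SetStr.{u}} {ρ : Cardinal.{u}} (h : MeasurableCrit M ρ)
    (hρ : ∀ κ : Cardinal.{u}, IsMeasurableCardinal κ → ρ < κ) : M.IsMaximal := by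
  intro N hN j
  by_contra hj
  obtain ⟨κ, hκ, hm, -⟩ := h N hN j hj
  exact (hρ κ hm).not_ge hκ

section Spectrum

variable {σ : lang.Sentence}
  (hσ : ∀ M : SetStr.{u}, M.Transitive → (M.Dom ⊨ σ ↔ InsertClosed M ∧ LAxioms M))
include hσ

lemma includesVEqLA : IncludesVEqLA.{u} {σ} := by
  intro M hM h
  obtain ⟨hI, ax⟩ := (hσ M hM).1 (SetStr.models_singleton.1 h)
  obtain ⟨α, hα⟩ := hM.exists_hasHeight
  exact ⟨α, hI.isSuccLimit hα, ax.eq_LL hI hα⟩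

lemma models_LStr {A : Set ZFSet.{u}} {α : Ordinal.{u}} (hα : Order.IsSuccLimit α) :
    (LStr A α).Models {σ} ↔ LAxioms (LStr A α) := by
  rw [SetStr.models_singleton, hσ _ (insertClosed_LStr hα).trans]
  exact and_iff_right (insertClosed_LStr hα)

lemma measurableCrit_LStr {ρ : Cardinal.{u}} (hρ : ℵ₀ ≤ ρ) {A : Set ZFSet.{u}} {α : Ordinal.{u}}
    (hα : Order.IsSuccLimit α) (hcode : CodesPowerset A ρ α) (h : (LStr A α).Models {σ}) :
    MeasurableCrit (LStr A α) ρ := by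
  intro N hN j hj
  obtain ⟨hI, axN⟩ := (hσ N hN).1 (SetStr.models_singleton.1 (j.models h))
  exact exists_measurable_crit_LStr hα hcode ((models_LStr hσ hα).1 h) hI hρ axN hj

lemma exists_mem_Sp {ρ : Cardinal.{u}} (h₀ : ℵ₀ ≤ ρ)
    (hρ : ∀ κ : Cardinal.{u}, IsMeasurableCardinal κ → ρ < κ) :
    ∃ α ∈ Sp.{u} {σ}, ρ < α.card := by
  obtain ⟨α, A, hα, hcode, ax⟩ := exists_model h₀
  have h := (models_LStr hσ hα).2 ax
  exact ⟨α, ⟨_, (insertClosed_LStr hα).trans, h, hasHeight_LStr A α,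
    (measurableCrit_LStr hσ h₀ hα hcode h).isMaximal hρ⟩, hcode.card_eq ▸ cantor ρ⟩

omit hσ in
lemma le_ord_of_mem_Sp {T : lang.Theory} {κ : Cardinal.{u}} (hκ : IsMeasurableCardinal κ)
    {α : Ordinal.{u}} (hα : α ∈ Sp.{u} T) : α ≤ κ.ord := by
  obtain ⟨M, hM, -, hh, hmax⟩ := hα
  by_contra! h
  exact not_isMaximal_of_measurable hM hκ ((hh _).2 h) hmax

lemma exists_mem_Sp_gt {b : Ordinal.{u}}
    (hb : ∀ κ : Cardinal.{u}, IsMeasurableCardinal κ → b < κ.ord) : ∃ α ∈ Sp.{u} {σ}, b < α := by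
  -- Take `ρ` infinite and at least the cardinality of `b`; it stays below every measurable because
  -- measurables are uncountable.
  obtain ⟨α, hα, h⟩ := exists_mem_Sp hσ (le_max_left ℵ₀ b.card) fun κ hκ =>
    max_lt hκ.1 (Cardinal.lt_ord.1 (hb κ hκ))
  exact ⟨α, hα, lt_of_not_ge fun hle =>
    ((le_max_right _ _).trans_lt h).not_ge (Ordinal.card_le_card hle)⟩

lemma bddAbove_Sp_iff :
    BddAbove (Sp.{u} {σ}) ↔ ∃ κ : Cardinal.{u}, IsMeasurableCardinal κ := by
  refine ⟨fun ⟨b, hb⟩ => ?_, fun ⟨κ, hκ⟩ => ⟨κ.ord, fun α hα => le_ord_of_mem_Sp hκ hα⟩⟩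
  by_contra! hne
  obtain ⟨α, hα, h⟩ := exists_mem_Sp_gt hσ (b := b) fun κ hκ => absurd hκ (hne κ)
  exact (hb hα).not_gt h

lemma isLUB_Sp {κ : Cardinal.{u}}
    (hκ : IsLeast {μ : Cardinal.{u} | IsMeasurableCardinal μ} κ) : IsLUB (Sp.{u} {σ}) κ.ord := by
  refine ⟨fun α hα => le_ord_of_mem_Sp hκ.1 hα, fun b hb => ?_⟩
  by_contra! hlt
  obtain ⟨α, hα, h⟩ := exists_mem_Sp_gt hσ (b := b) fun μ hμ =>
    hlt.trans_le (ord_le_ord.2 (hκ.2 hμ))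
  exact (hb hα).not_gt h

end Spectrum

end TransSpectra

/-! ### The theorem -/

theorem mainTheorem6 :
    (∃ T : TransSpectra.lang.Theory,
      TransSpectra.IsRecursiveTheory T ∧ TransSpectra.IncludesVEqLA.{u} T ∧
      -- the spectrum is bounded iff there is a measurable cardinal
      (BddAbove (TransSpectra.Sp.{u} T) ↔
        ∃ κ : Cardinal.{u}, TransSpectra.IsMeasurableCardinal κ) ∧
      -- and then its supremum is the least one
      (∀ κ : Cardinal.{u}, IsLeast {μ : Cardinal.{u} | TransSpectra.IsMeasurableCardinal μ} κ →
        IsLUB (TransSpectra.Sp.{u} T) κ.ord) ∧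
      -- `T` has models `L_α[A]` with `A` enumerating `𝒫(ρ)`, for every infinite `ρ`
      (∀ ρ : Cardinal.{u}, Cardinal.aleph0 ≤ ρ → ∃ (α : Ordinal.{u}) (A : Set ZFSet.{u}),
        Order.IsSuccLimit α ∧ TransSpectra.CodesPowerset A ρ α ∧
          (TransSpectra.LStr A α).Models T) ∧
      -- and such models are maximal if `ρ` is below the first measurable
      (∀ ρ : Cardinal.{u}, Cardinal.aleph0 ≤ ρ → ∀ (α : Ordinal.{u}) (A : Set ZFSet.{u}),
        Order.IsSuccLimit α → TransSpectra.CodesPowerset A ρ α →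
        (TransSpectra.LStr A α).Models T →
          TransSpectra.MeasurableCrit (TransSpectra.LStr A α) ρ ∧
          ((∀ κ : Cardinal.{u}, TransSpectra.IsMeasurableCardinal κ → ρ < κ) →
            (TransSpectra.LStr A α).IsMaximal))) ∧
    -- likewise for `H(ρ⁺)`, with any interpretation of the predicate
    (∀ ρ : Cardinal.{u}, Cardinal.aleph0 ≤ ρ → ∀ A : Set ZFSet.{u},
      TransSpectra.MeasurableCrit ⟨TransSpectra.HH (Order.succ ρ), A⟩ ρ ∧
      ((∀ κ : Cardinal.{u}, TransSpectra.IsMeasurableCardinal κ → ρ < κ) →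
        TransSpectra.SetStr.IsMaximal ⟨TransSpectra.HH (Order.succ ρ), A⟩)) := by
  obtain ⟨σ, hσ⟩ := TransSpectra.exists_sentence.{u}
  refine ⟨⟨{σ}, TransSpectra.isRecursiveTheory_singleton σ, TransSpectra.includesVEqLA hσ,
    TransSpectra.bddAbove_Sp_iff hσ, fun κ hκ => TransSpectra.isLUB_Sp hσ hκ,
    fun ρ hρ => ?_, fun ρ hρ α A hα hcode h => ?_⟩, fun ρ hρ A => ?_⟩
  · obtain ⟨α, A, hα, hcode, ax⟩ := TransSpectra.exists_model hρ
    exact ⟨α, A, hα, hcode, (TransSpectra.models_LStr hσ hα).2 ax⟩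
  · have hcrit := TransSpectra.measurableCrit_LStr hσ hρ hα hcode h
    exact ⟨hcrit, hcrit.isMaximal⟩
  · have hcrit := TransSpectra.measurableCrit_HH hρ A
    exact ⟨hcrit, hcrit.isMaximal⟩
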